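/- **Model.** The network has $n$ nodes with identifiers $1,\dots,n$, joined by *local* edges, which form a connected undirected graph $G=(V,E,w)$ with weights $w:E\to\{1,\dots,W\}$, where $W\le n^{\kappa}$ for a constant $\kappa$, and by *global* edges, which form a clique on $V$. Initially a node knows $n$, its identifier and its incident local edges with their weights. It has private randomness, independent of that of the other nodes, and its local computation is unrestricted. Time is divided into synchronous rounds. In every round each node can send arbitrarily many messages over each of its local edges, and it can send at most $\gamma=\lceil a\ln n\rceil$ global messages of $O(\log n)$ bits, each to a node of its choice, where $a>0$ is a constant. If at most $\gamma$ global messages are addressed to a node in a round, it receives all of them; otherwise an adversary chooses at most $\gamma$ of them to deliver and drops the others. Write $d(u,v)$ for the minimum length $\sum_{e\in P}w(e)$ of a $u$-$v$-path $P$ in $G$. **Theorem.** A 3-approximation of all-pairs shortest paths can be computed in $\tilde O(\sqrt n)$ rounds with high probability. That is: for every $\kappa\in\mathbb N$ there is a constant $B$ such that for all $a>0$ and $c>0$ there are constants $C,k,n_0$ and a randomized algorithm in this model, using global messages of $B\lceil\log_2 n\rceil$ bits and running for $T(n)$ rounds, with the following properties for all $n\ge n_0$: $T(n)\le C\sqrt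 n\,(\ln n)^k$; and on every connected graph $G$ as above, with probability at least $1-n^{-c}$ over the private randomness of the nodes, whatever the adversary does, in no round more than $\gamma$ global messages are addressed to one node, and after $T(n)$ rounds every node $u$ outputs values $d'(u,v)$ with $$d(u,v)\le d'(u,v)\le 3\,d(u,v)\qquad\text{for all }v\in V .$$ -/

import Mathlib

namespace Hybrid

/-- The local network: an undirected graph on the nodes `Fin n` (the node identifiers) with positive
integer edge weights. Only the values of `weight` on edges of `graph` are ever used. -/
structure WeightedGraph (n : ℕ) where
  graph : SimpleGraph (Fin n)
  weight : Sym2 (Fin n) → ℕ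
  weight_pos : ∀ e ∈ graph.edgeSet, 1 ≤ weight e

namespace WeightedGraph

variable {n : ℕ} (G : WeightedGraph n)

/-- The length of a walk: the sum of the weights of its edges. -/
def length {u v : Fin n} (p : G.graph.Walk u v) : ℕ :=
  (p.edges.map G.weight).sum

/-- The distance: the minimum length of a path (`⊤` if there is none). -/
noncomputable def dist (u v : Fin n) : ℕ∞ :=
  ⨅ p : G.graph.Path u v, (G.length (p : G.graph.Walk u v) : ℕ∞)

open Classical in
/-- What node `v` knows about the graph initially: its neighbours and the weights of its incident
edges (`none` at nodes that are not neighbours of `v`). -/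
noncomputable def view (v : Fin n) : Fin n → Option ℕ := fun u =>
  if G.graph.Adj v u then some (G.weight s(v, u)) else none

end WeightedGraph

/-- A message of `b` bits. -/
abbrev Message (b : ℕ) : Type := Fin b → Bool

/-- A synchronous randomized algorithm for `n` nodes with uncapacitated local edges, global messages
of `b` bits, and global capacity `γ`. Local computation is not restricted, and all nodes run the
same program, which may depend on `n`. -/
structure Algorithm (n b γ : ℕ) where
  /-- The private randomness of a node is a uniformly random element of this finite set. -/
  Seed : Type
  [seedFinite : Finite Seed]
  [seedNonempty : Nonempty Seed]
  /-- The internal states of a node. -/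
  State : Type
  /-- What is sent over one local edge in one direction in one round: since the number of messages
  over a local edge is not bounded, this may be any set. -/
  LocalMsg : Type
  /-- The initial state, from the identifier, the incident weighted edges and the randomness. -/
  init : Fin n → (Fin n → Option ℕ) → Seed → State
  /-- What a node sends over the local edge to a given neighbour. -/
  localSend : State → Fin n → LocalMsg
  /-- The at most `γ` global messages a node sends in a round, each with its target. -/
  globalSend : State → Fin γ → Option (Fin n × Message b)
  /-- The next state, from what arrived over the local edges (`none` from nodes that are not
  neighbours) and the global messages received, each with its sender. -/
  update : State → (Fin n → Option LocalMsg) → Multiset (Fin n × Message b) → State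
  /-- The values `d'(u, v)` for all `v` that a node `u` in the given state outputs. -/
  output : State → Fin n → ℕ

namespace Algorithm

variable {n b γ : ℕ} (A : Algorithm n b γ)

open Classical in
/-- What arrives at `v` over the local edges, when the nodes are in the states `s`. -/
noncomputable def localInbox (G : WeightedGraph n) (s : Fin n → A.State) (v : Fin n) :
    Fin n → Option A.LocalMsg := fun u =>
  if G.graph.Adj v u then some (A.localSend (s u) v) else none

/-- The global messages addressed to `v`, each with its sender, when the nodes are in the
states `s`. -/
def addressed (s : Fin n → A.State) (v : Fin n) : Multiset (Fin n × Message b) :=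
  (Finset.univ : Finset (Fin n × Fin γ)).val.filterMap fun p =>
    (A.globalSend (s p.1) p.2).bind fun tm => if tm.1 = v then some (p.1, tm.2) else none

/-- `recv` is a possible delivery when the messages `sent` are addressed to a node: everything is
delivered if these are at most `γ` messages; otherwise an adversary chooses which of them to deliver
(never more than `γ`) and drops the others. -/
def Delivery (γ : ℕ) {α : Type} (sent recv : Multiset α) : Prop :=
  recv ≤ sent ∧ recv.card ≤ γ ∧ (sent.card ≤ γ → recv = sent)

/-- `s t v` is the state of node `v` after `t` rounds in some execution on `G` in which the private
randomness of the nodes is `ω`. The executions for a given `ω` differ in the adversary's choices. -/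
structure IsExecution (G : WeightedGraph n) (ω : Fin n → A.Seed) (s : ℕ → Fin n → A.State) :
    Prop where
  init : ∀ v, s 0 v = A.init v (G.view v) (ω v)
  step : ∀ t v, ∃ recv, Delivery γ (A.addressed (s t) v) recv ∧
    s (t + 1) v = A.update (s t v) (A.localInbox G (s t) v) recv

/-- The probability of an event over the independent, uniform private randomness of the nodes. -/
noncomputable def prob (E : Set (Fin n → A.Seed)) : ℝ :=
  (E.ncard : ℝ) / (Nat.card (Fin n → A.Seed) : ℝ)

/-- The outcomes of the private randomness for which, whatever the adversary does, in the first `T`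
rounds no node is addressed by more than `γ` global messages in one round, and after `T` rounds every
node `u` outputs values `d'(u, v)` with `d(u, v) ≤ d'(u, v) ≤ α * d(u, v)` for all `v`. -/
def approxAPSPEvent (G : WeightedGraph n) (T α : ℕ) : Set (Fin n → A.Seed) :=
  {ω | ∀ s, A.IsExecution G ω s →
    (∀ t < T, ∀ v, (A.addressed (s t) v).card ≤ γ) ∧
    ∀ u v, G.dist u v ≤ (A.output (s T u) v : ℕ∞) ∧
      (A.output (s T u) v : ℕ∞) ≤ (α : ℕ∞) * G.dist u v}

end Algorithm

end Hybrid

/-! Put q = ⌊√n⌋ + 1 and h = qL with L = Θ(log n), and sample every node with probability 1/q. With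
high probability, every chosen shortest path with more than h edges has a sampled node among the
first h nodes after its start (`frac_path`). Exact distances to and between sampled nodes are
therefore sums of distances over stretches of at most h edges, which local flooding finds
(`chain_sampled`, `chain_to_sampled`).

It remains to tell everybody the distances between nearby sampled nodes and, for each v, a nearest
sampled node. The pair {p, p'} is handed to node p + p' modulo n. At most q² pairs have a given sum,
each sampled with probability 1/q², so a node gets at most γ of them (`frac_pair`). Each node then
sends each of its at most γ + 1 messages to h random targets. A ball of h hops contains at least q
nodes, so some target lies close enough to any given u for the message to reach u by flooding
(`frac_cover`, `exists_known_of_slot`).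

If v is far from u, a shortest path from v to u has a sampled node x near v. The sampled p reported
by v satisfies d(v,p) ≤ d(v,x) ≤ d(u,v), hence d(u,p) + d(p,v) ≤ d(u,v) + 2 d(v,p) ≤ 3 d(u,v)
(`exists_chain_le`). Nothing below the true distance is ever derived (`sound`).

All that is needed of the randomness is `GoodSeeds`, a condition on the seeds alone. It bounds the
load of every node by γ in every execution (`addressed_card_le`), so the adversary never gets a
choice. Each of its polynomially many parts fails with probability at most (1 - 1/q)^h or 1/(γ+1)!,
and a union bound finishes the proof. -/

namespace Hybrid

/-! ### Finite uniform probability: union bounds, a tail bound, independence -/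

/-- The probability of an event under the uniform distribution on a finite type. -/
noncomputable def frac {Ω : Type*} (E : Set Ω) : ℝ := (E.ncard : ℝ) / (Nat.card Ω : ℝ)

section Frac

variable {Ω : Type*}

lemma frac_nonneg (E : Set Ω) : 0 ≤ frac E := by unfold frac; positivity

lemma frac_mono [Finite Ω] {E F : Set Ω} (h : E ⊆ F) : frac E ≤ frac F := by
  unfold frac
  gcongr
  exact F.toFinite

lemma frac_union_le (E F : Set Ω) : frac (E ∪ F) ≤ frac E + frac F := by
  unfold frac
  rw [← add_div]
  gcongr
  exact_mod_cast Set.ncard_union_le E F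

lemma frac_biUnion_le {ι : Type*} (s : Finset ι) (E : ι → Set Ω) :
    frac (⋃ i ∈ s, E i) ≤ ∑ i ∈ s, frac (E i) := by
  classical
  induction s using Finset.induction_on with
  | empty => simp [frac]
  | insert a s ha ih =>
    rw [Finset.set_biUnion_insert, Finset.sum_insert ha]
    exact (frac_union_le _ _).trans (by gcongr)

lemma frac_biUnion_le_card_mul {ι : Type*} (s : Finset ι) (E : ι → Set Ω) {x : ℝ}
    (hx : ∀ i ∈ s, frac (E i) ≤ x) : frac (⋃ i ∈ s, E i) ≤ s.card * x := by
  refine (frac_biUnion_le s E).trans ?_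
  simpa using Finset.sum_le_sum hx

lemma frac_iUnion_le_card_mul {ι : Type*} [Fintype ι] (E : ι → Set Ω) {x : ℝ}
    (hx : ∀ i, frac (E i) ≤ x) : frac (⋃ i, E i) ≤ Fintype.card ι * x := by
  simpa using frac_biUnion_le_card_mul Finset.univ E fun i _ => hx i

lemma one_sub_frac_compl_le [Finite Ω] [Nonempty Ω] (E : Set Ω) : 1 - frac Eᶜ ≤ frac E := by
  have h : frac (E ∪ Eᶜ) = 1 := by
    have : (Nat.card Ω : ℝ) ≠ 0 := by exact_mod_cast Nat.card_pos.ne'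
    simp [frac, Set.ncard_univ, this]
  linarith [frac_union_le E Eᶜ]

/-- If every `m` of at most `N` events hold together with probability at most `ρ ^ m`, and
`N * ρ ≤ 1`, then the probability that `m` of them hold is at most `1 / m!`. -/
lemma frac_exists_card_eq_le [Finite Ω] {ι : Type*} [DecidableEq ι] (Y : Finset ι) (F : ι → Set Ω) (m : ℕ)
    {ρ : ℝ} (hρ : 0 ≤ ρ) (hY : Y.card * ρ ≤ 1)
    (hF : ∀ J ⊆ Y, J.card = m → frac {ω | ∀ j ∈ J, ω ∈ F j} ≤ ρ ^ m) :
    frac {ω | ∃ J ⊆ Y, J.card = m ∧ ∀ j ∈ J, ω ∈ F j} ≤ 1 / (m.factorial : ℝ) := by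
  have h1 : {ω | ∃ J ⊆ Y, J.card = m ∧ ∀ j ∈ J, ω ∈ F j} ⊆
      ⋃ J ∈ Y.powersetCard m, {ω | ∀ j ∈ J, ω ∈ F j} := by
    rintro ω ⟨J, hJ, hm, h⟩
    simp only [Set.mem_iUnion, Finset.mem_powersetCard]
    exact ⟨J, ⟨hJ, hm⟩, h⟩
  refine (frac_mono h1).trans ((frac_biUnion_le_card_mul _ _ (x := ρ ^ m) ?_).trans ?_)
  · intro J hJ
    rw [Finset.mem_powersetCard] at hJ
    exact hF J hJ.1 hJ.2
  · rw [Finset.card_powersetCard]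
    calc ((Y.card.choose m : ℕ) : ℝ) * ρ ^ m
        ≤ (Y.card : ℝ) ^ m / (m.factorial : ℝ) * ρ ^ m := by
          gcongr; exact Nat.choose_le_pow_div m Y.card
      _ = (Y.card * ρ) ^ m / (m.factorial : ℝ) := by rw [mul_pow]; ring
      _ ≤ 1 / (m.factorial : ℝ) := by
          gcongr; exact pow_le_one₀ (by positivity) hY

end Frac

/-- Independence of the coordinates. -/
lemma frac_pi {ι α : Type*} [Fintype ι] [DecidableEq ι] [Finite α] [Nonempty α]
    (J : Finset ι) (A : Set α) :
    frac {ω : ι → α | ∀ i ∈ J, ω i ∈ A} = frac A ^ J.card := by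
  classical
  have := Fintype.ofFinite α
  have hα : (Fintype.card α : ℝ) ≠ 0 := by exact_mod_cast Fintype.card_ne_zero
  have h1 : {ω : ι → α | ∀ i ∈ J, ω i ∈ A} =
      ((Fintype.piFinset fun i => if i ∈ J then A.toFinset else Finset.univ : Finset (ι → α)) :
        Set (ι → α)) := by
    ext ω
    simp only [Set.mem_ofPred_eq, Finset.mem_coe, Fintype.mem_piFinset]
    refine forall_congr' fun i => ?_
    by_cases hi : i ∈ J <;> simp [hi]
  unfold frac
  rw [h1, Set.ncard_coe_finset, Fintype.card_piFinset, Nat.card_eq_fintype_card,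
    Nat.card_eq_fintype_card, Fintype.card_fun, Set.ncard_eq_toFinset_card']
  have h2 : ∀ i : ι, (if i ∈ J then A.toFinset else (Finset.univ : Finset α)).card =
      if i ∈ J then A.toFinset.card else Fintype.card α := by
    intro i; split_ifs <;> simp
  simp only [h2]
  rw [Finset.prod_ite]
  simp only [Finset.prod_const, Finset.filter_mem_eq_inter, Finset.univ_inter]
  rw [← Finset.compl_filter, Finset.filter_mem_eq_inter, Finset.univ_inter, Finset.card_compl]
  have h3 : Fintype.card ι = J.card + (Fintype.card ι - J.card) :=
    (Nat.add_sub_cancel' (Finset.card_le_univ J)).symm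
  conv_lhs => rw [h3]
  push_cast
  rw [div_pow, pow_add, Nat.add_sub_cancel_left]
  field_simp

lemma frac_fst {α β : Type*} [Finite α] [Finite β] [Nonempty β] (A : Set α) :
    frac {x : α × β | x.1 ∈ A} = frac A := by
  have h : {x : α × β | x.1 ∈ A} = A ×ˢ Set.univ := by ext; simp
  have hβ : (Nat.card β : ℝ) ≠ 0 := by exact_mod_cast Nat.card_pos.ne'
  unfold frac
  rw [h, Set.ncard_prod, Set.ncard_univ, Nat.card_prod]
  push_cast
  field_simp

lemma frac_snd {α β : Type*} [Finite α] [Finite β] [Nonempty α] (B : Set β) :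
    frac {x : α × β | x.2 ∈ B} = frac B := by
  have h : {x : α × β | x.2 ∈ B} = Set.univ ×ˢ B := by ext; simp
  have hα : (Nat.card α : ℝ) ≠ 0 := by exact_mod_cast Nat.card_pos.ne'
  unfold frac
  rw [h, Set.ncard_prod, Set.ncard_univ, Nat.card_prod]
  push_cast
  field_simp

lemma frac_compl {α : Type*} [Finite α] [Nonempty α] (A : Set α) : frac Aᶜ = 1 - frac A := by
  have hα : (Nat.card α : ℝ) ≠ 0 := by exact_mod_cast Nat.card_pos.ne'
  have h : (A.ncard : ℝ) + (Aᶜ.ncard : ℝ) = Nat.card α := by exact_mod_cast A.ncard_add_ncard_compl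
  unfold frac
  field_simp
  linarith

lemma frac_singleton {α : Type*} (x : α) : frac {x} = 1 / (Nat.card α : ℝ) := by
  simp [frac]

/-- A single coordinate of a family. -/
lemma frac_eval {ι α : Type*} [Fintype ι] [DecidableEq ι] [Finite α] [Nonempty α] (i : ι)
    (A : Set α) : frac {ω : ι → α | ω i ∈ A} = frac A := by
  simpa using frac_pi {i} A
-- Distances, geodesics and hop balls
namespace WeightedGraph

variable {n : ℕ} (G : WeightedGraph n)

@[simp] lemma length_nil {u : Fin n} : G.length (SimpleGraph.Walk.nil : G.graph.Walk u u) = 0 := rfl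

@[simp] lemma length_cons {u v w : Fin n} (h : G.graph.Adj u v) (p : G.graph.Walk v w) :
    G.length (SimpleGraph.Walk.cons h p) = G.weight s(u, v) + G.length p := by
  simp [length]

@[simp] lemma length_append {u v w : Fin n} (p : G.graph.Walk u v) (r : G.graph.Walk v w) :
    G.length (p.append r) = G.length p + G.length r := by
  simp [length, SimpleGraph.Walk.edges_append]

@[simp] lemma length_reverse {u v : Fin n} (p : G.graph.Walk u v) :
    G.length p.reverse = G.length p := by
  simp [length, SimpleGraph.Walk.edges_reverse, List.sum_reverse]

/-- Cutting out closed detours only discards edges. This lets distances be computed over walks,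
which concatenate freely, instead of paths. -/
lemma length_bypass_le {u v : Fin n} (p : G.graph.Walk u v) : G.length p.bypass ≤ G.length p := by
  induction p with
  | nil => simp [SimpleGraph.Walk.bypass]
  | cons h p ih =>
    rw [SimpleGraph.Walk.bypass]
    split_ifs with hs
    · have h1 := congrArg G.length (p.bypass.take_spec hs)
      rw [length_append] at h1
      rw [length_cons]
      omega
    · simp only [length_cons]
      omega

/-- The minimum length of a walk, as a natural number. -/
noncomputable def natDist (u v : Fin n) : ℕ := sInf {l | ∃ p : G.graph.Walk u v, G.length p = l}

variable {G}

lemma natDist_le {u v : Fin n} (p : G.graph.Walk u v) : G.natDist u v ≤ G.length p :=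
  Nat.sInf_le ⟨p, rfl⟩

lemma exists_length_eq_natDist (hG : G.graph.Connected) (u v : Fin n) :
    ∃ p : G.graph.Walk u v, G.length p = G.natDist u v := by
  obtain ⟨p⟩ := hG.preconnected u v
  exact Nat.sInf_mem (s := {l | ∃ p : G.graph.Walk u v, G.length p = l}) ⟨_, p, rfl⟩

lemma dist_eq_natDist (hG : G.graph.Connected) (u v : Fin n) : G.dist u v = G.natDist u v := by
  apply le_antisymm
  · obtain ⟨p, hp⟩ := exists_length_eq_natDist hG u v
    refine (iInf_le _ (⟨p.bypass, p.bypass_isPath⟩ : G.graph.Path u v)).trans ?_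
    rw [← hp]
    exact_mod_cast G.length_bypass_le p
  · refine le_iInf fun p => ?_
    exact_mod_cast natDist_le (p : G.graph.Walk u v)

lemma natDist_triangle (hG : G.graph.Connected) (u v w : Fin n) :
    G.natDist u w ≤ G.natDist u v + G.natDist v w := by
  obtain ⟨p, hp⟩ := exists_length_eq_natDist hG u v
  obtain ⟨r, hr⟩ := exists_length_eq_natDist hG v w
  rw [← hp, ← hr, ← length_append]
  exact natDist_le _

lemma natDist_comm (hG : G.graph.Connected) (u v : Fin n) : G.natDist u v = G.natDist v u := by
  have key : ∀ u v, G.natDist u v ≤ G.natDist v u := fun u v => by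
    obtain ⟨p, hp⟩ := exists_length_eq_natDist hG v u
    rw [← hp, ← length_reverse]
    exact natDist_le _
  exact (key u v).antisymm (key v u)

lemma length_le_length_mul {W : ℕ} (hW : ∀ e ∈ G.graph.edgeSet, G.weight e ≤ W) {u v : Fin n}
    (p : G.graph.Walk u v) : G.length p ≤ p.length * W := by
  induction p with
  | nil => simp
  | cons h p ih =>
    rw [length_cons, SimpleGraph.Walk.length_cons, add_mul, one_mul, add_comm]
    exact add_le_add ih (hW _ h)

lemma natDist_lt {κ : ℕ} (hG : G.graph.Connected) (hn : 0 < n)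
    (hW : ∀ e ∈ G.graph.edgeSet, G.weight e ≤ n ^ κ) (u v : Fin n) :
    G.natDist u v < n ^ (κ + 1) := by
  obtain ⟨p⟩ := hG.preconnected u v
  have h1 := p.bypass_isPath.length_lt
  rw [Fintype.card_fin] at h1
  calc G.natDist u v ≤ G.length p.bypass := natDist_le _
    _ ≤ p.bypass.length * n ^ κ := length_le_length_mul hW _
    _ < n * n ^ κ := by gcongr
    _ = n ^ (κ + 1) := by ring

/-- A shortest walk with as few edges as possible. -/
lemma exists_geodesic (hG : G.graph.Connected) (u v : Fin n) :
    ∃ p : G.graph.Walk u v, G.length p = G.natDist u v ∧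
      ∀ r : G.graph.Walk u v, G.length r = G.natDist u v → p.length ≤ r.length := by
  obtain ⟨p, hp⟩ := exists_length_eq_natDist hG u v
  have hne : {k | ∃ p : G.graph.Walk u v, G.length p = G.natDist u v ∧ p.length = k}.Nonempty :=
    ⟨_, p, hp, rfl⟩
  obtain ⟨r, hr, hk⟩ := Nat.sInf_mem hne
  exact ⟨r, hr, fun r' hr' => hk ▸ Nat.sInf_le ⟨r', hr', rfl⟩⟩

/-- Fixing one path per pair of nodes leaves only n² paths for the union bound. Minimality of the
edge count supplies the decreasing measure when a geodesic is cut. -/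
noncomputable def geodesic (hG : G.graph.Connected) (u v : Fin n) : G.graph.Walk u v :=
  (exists_geodesic hG u v).choose

lemma length_geodesic (hG : G.graph.Connected) (u v : Fin n) :
    G.length (geodesic hG u v) = G.natDist u v :=
  (exists_geodesic hG u v).choose_spec.1

lemma geodesic_length_le (hG : G.graph.Connected) {u v : Fin n} (r : G.graph.Walk u v)
    (hr : G.length r = G.natDist u v) : (geodesic hG u v).length ≤ r.length :=
  (exists_geodesic hG u v).choose_spec.2 r hr

/-- A repeated vertex could be bypassed without increasing the weight and with fewer edges.
Distinctness of the vertices is what makes their sampling independent. -/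
lemma geodesic_isPath (hG : G.graph.Connected) (u v : Fin n) : (geodesic hG u v).IsPath := by
  set p := geodesic hG u v
  have h1 : G.length p.bypass = G.natDist u v :=
    ((G.length_bypass_le p).trans_eq (length_geodesic hG u v)).antisymm (natDist_le _)
  have h2 : p.length ≤ p.bypass.length := geodesic_length_le hG _ h1
  have h3 : p.bypass = p := by
    by_contra hne
    exact absurd h2 (not_le.mpr (lt_of_le_of_ne p.length_bypass_le_length
      fun h => hne (SimpleGraph.Walk.bypass_eq_self_of_length_le_length_bypass p h.ge)))
  rw [← h3]
  exact p.bypass_isPath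

/-- A vertex in the interior of a geodesic splits it into two shortest walks. -/
lemma geodesic_split (hG : G.graph.Connected) (u v : Fin n) {i : ℕ}
    (hi : 1 ≤ i) (hi' : i < (geodesic hG u v).length) :
    (∃ p : G.graph.Walk u ((geodesic hG u v).getVert i), p.length = i ∧
        G.length p = G.natDist u ((geodesic hG u v).getVert i)) ∧
      G.natDist u ((geodesic hG u v).getVert i) + G.natDist ((geodesic hG u v).getVert i) v =
        G.natDist u v ∧
      (geodesic hG ((geodesic hG u v).getVert i) v).length < (geodesic hG u v).length := by
  set p := geodesic hG u v with hp
  have h1 : G.length (p.take i) + G.length (p.drop i) = G.natDist u v := by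
    rw [← length_append, SimpleGraph.Walk.append_take_drop_eq, hp, length_geodesic]
  have h2 := natDist_le (p.take i)
  have h3 := natDist_le (p.drop i)
  have h4 := natDist_triangle hG u (p.getVert i) v
  refine ⟨⟨p.take i, ?_, by omega⟩, by omega, ?_⟩
  · rw [SimpleGraph.Walk.take_length]
    omega
  · have := geodesic_length_le hG (p.drop i) (by omega)
    rw [SimpleGraph.Walk.drop_length] at this
    omega

/-- If some vertex lies farther than r hops away, the first r + 1 vertices of a path to it are
distinct and lie in the ball; otherwise the ball is everything. -/
lemma card_ball (hG : G.graph.Connected) (u : Fin n) (r : ℕ) :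
    min n (r + 1) ≤ (Finset.univ.filter fun x => G.graph.dist u x ≤ r).card := by
  by_cases hall : ∀ x, G.graph.dist u x ≤ r
  · simp [hall]
  · push Not at hall
    obtain ⟨x, hx⟩ := hall
    obtain ⟨p, hp, hl⟩ := hG.exists_path_of_dist u x
    refine (min_le_right _ _).trans ?_
    rw [← Finset.card_range (r + 1)]
    refine Finset.card_le_card_of_injOn p.getVert ?_ ?_
    · intro i hi
      simp only [Finset.coe_range, Set.mem_Iio] at hi
      simp only [Finset.coe_filter, Finset.mem_univ, true_and, Set.mem_ofPred_eq]
      refine (SimpleGraph.dist_le (p.take i)).trans ?_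
      rw [SimpleGraph.Walk.take_length]
      omega
    · intro i hi j hj hij
      simp only [Finset.coe_range, Set.mem_Iio] at hi hj
      exact hp.getVert_injOn (by simp; omega) (by simp; omega) hij

end WeightedGraph
-- Facts, their concatenation, and their encoding in messages
/-- The triple `(u, v, l)` stands for the assertion that there is a `u`-`v`-walk of length `l`. -/
abbrev Fact (n : ℕ) : Type := Fin n × Fin n × ℕ

/-- `Chain K u v l`: the facts in `K` can be concatenated to a `u`-`v`-walk of length `l`. -/
inductive Chain {n : ℕ} (K : Set (Fact n)) : Fin n → Fin n → ℕ → Prop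
  | refl (u : Fin n) : Chain K u u 0
  | forward {u v w : Fin n} {l l' : ℕ} : (u, v, l) ∈ K → Chain K v w l' → Chain K u w (l + l')
  | backward {u v w : Fin n} {l l' : ℕ} : (v, u, l) ∈ K → Chain K v w l' → Chain K u w (l + l')

namespace Chain

variable {n : ℕ} {K K' : Set (Fact n)} {u v w : Fin n} {l l' : ℕ}

lemma mono (hK : K ⊆ K') (h : Chain K u v l) : Chain K' u v l := by
  induction h with
  | refl u => exact .refl u
  | forward h _ ih => exact .forward (hK h) ih
  | backward h _ ih => exact .backward (hK h) ih

lemma trans (h : Chain K u v l) (h' : Chain K v w l') : Chain K u w (l + l') := by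
  induction h with
  | refl u => simpa using h'
  | forward h _ ih => rw [add_assoc]; exact .forward h (ih h')
  | backward h _ ih => rw [add_assoc]; exact .backward h (ih h')

lemma of_mem (h : (u, v, l) ∈ K) : Chain K u v l := by simpa using Chain.forward h (.refl v)

lemma of_mem_symm (h : (v, u, l) ∈ K) : Chain K u v l := by simpa using Chain.backward h (.refl v)

end Chain

/-- A fact with bounded length, which can be sent as a message. -/
abbrev Token (n κ : ℕ) : Type := Fin n × Fin n × Fin (n ^ (κ + 1))

abbrev Token.fact {n κ : ℕ} (x : Token n κ) : Fact n := (x.1, x.2.1, (x.2.2 : ℕ))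

/-- The number of bits of a message. -/
abbrev bits (n κ : ℕ) : ℕ := (κ + 3) * Nat.clog 2 n

/-- There are n^(κ+3) tokens, two identifiers and a length below n^(κ+1); this is where the constant
B = κ + 3 comes from. -/
lemma nonempty_code (n κ : ℕ) : Nonempty (Token n κ ↪ Message (bits n κ)) := by
  apply Function.Embedding.nonempty_of_card_le
  simp only [Fintype.card_prod, Fintype.card_fin, Fintype.card_fun, Fintype.card_bool]
  calc n * (n * n ^ (κ + 1)) = n ^ (κ + 3) := by ring
    _ ≤ (2 ^ Nat.clog 2 n) ^ (κ + 3) := by gcongr; exact Nat.le_pow_clog (by norm_num) n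
    _ = 2 ^ bits n κ := by rw [← pow_mul, mul_comm]

noncomputable def code (n κ : ℕ) : Token n κ ↪ Message (bits n κ) := (nonempty_code n κ).some

/-- A set, because bit strings outside the range of `code` carry no fact; by injectivity it has at
most one element. -/
def decode {n κ : ℕ} (m : Message (bits n κ)) : Set (Fact n) := {f | ∃ x, code n κ x = m ∧ x.fact = f}

@[simp] lemma mem_decode_code {n κ : ℕ} (x : Token n κ) (f : Fact n) :
    f ∈ decode (code n κ x) ↔ f = x.fact := by
  constructor
  · rintro ⟨y, hy, rfl⟩
    rw [(code n κ).injective hy]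
  · rintro rfl
    exact ⟨x, rfl, rfl⟩

/-! ### Node states and the algorithm -/

/-- The randomness of a node: whether it is sampled (first component `0`), and a random target for
each of `R` rounds. -/
abbrev Seed (n q R : ℕ) : Type := Fin q × (Fin R → Fin n)

structure NodeState (n κ q R : ℕ) where
  clock : ℕ
  id : Fin n
  seed : Seed n q R
  /-- The facts known to the node. -/
  known : Set (Fact n)
  /-- The nodes that the node knows to be sampled. -/
  sampled : Set (Fin n)
  /-- The messages that the node has to spread. -/
  held : List (Message (bits n κ))

section Tokens

variable {n : ℕ} (κ : ℕ) (K : Set (Fact n)) (S : Set (Fin n))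

open Classical in
/-- The message saying how far apart `p` and `p'` are, according to `K`. -/
noncomputable def pairMessage (p p' : Fin n) : Option (Message (bits n κ)) :=
  if h : ∃ l : Fin (n ^ (κ + 1)), Chain K p p' l ∧ ∀ l', Chain K p p' l' → l ≤ l' then
    some (code n κ (p, p', h.choose)) else none

open Classical in
/-- The message saying which node of `S` is nearest to `v`, and how far away, according to `K`. -/
noncomputable def nearestMessage (v : Fin n) : Option (Message (bits n κ)) :=
  if h : ∃ x : Fin n × Fin (n ^ (κ + 1)), x.1 ∈ S ∧ Chain K v x.1 x.2 ∧
      ∀ p ∈ S, ∀ l, Chain K v p l → x.2 ≤ l then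
    some (code n κ (v, h.choose)) else none

variable {κ K S}

lemma pairMessage_eq_some {p p' : Fin n} {m} (h : pairMessage κ K p p' = some m) :
    ∃ l : Fin (n ^ (κ + 1)), m = code n κ (p, p', l) ∧ Chain K p p' l := by
  unfold pairMessage at h
  split_ifs at h with hh
  exact ⟨_, (Option.some.inj h).symm, hh.choose_spec.1⟩

lemma exists_pairMessage {p p' : Fin n} {d : ℕ} (hd : d < n ^ (κ + 1)) (hc : Chain K p p' d)
    (hmin : ∀ l, Chain K p p' l → d ≤ l) :
    pairMessage κ K p p' = some (code n κ (p, p', ⟨d, hd⟩)) := by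
  have hh : ∃ l : Fin (n ^ (κ + 1)), Chain K p p' l ∧ ∀ l', Chain K p p' l' → l ≤ l' :=
    ⟨⟨d, hd⟩, hc, hmin⟩
  have : hh.choose = ⟨d, hd⟩ := Fin.ext
    ((hh.choose_spec.2 _ hc).antisymm (hmin _ hh.choose_spec.1))
  unfold pairMessage
  rw [dif_pos hh, this]

lemma nearestMessage_eq_some {v : Fin n} {m} (h : nearestMessage κ K S v = some m) :
    ∃ (p : Fin n) (l : Fin (n ^ (κ + 1))), m = code n κ (v, p, l) ∧ p ∈ S ∧ Chain K v p l ∧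
      ∀ p ∈ S, ∀ l', Chain K v p l' → l ≤ l' := by
  unfold nearestMessage at h
  split_ifs at h with hh
  exact ⟨_, _, (Option.some.inj h).symm, hh.choose_spec⟩

lemma exists_nearestMessage {v x : Fin n} {d : ℕ} (hd : d < n ^ (κ + 1)) (hx : x ∈ S)
    (hc : Chain K v x d) : ∃ m, nearestMessage κ K S v = some m := by
  have hne : {l | ∃ p ∈ S, Chain K v p l}.Nonempty := ⟨d, x, hx, hc⟩
  obtain ⟨p, hp, hl⟩ := Nat.sInf_mem hne
  have hmin : ∀ p ∈ S, ∀ l, Chain K v p l → sInf {l | ∃ p ∈ S, Chain K v p l} ≤ l :=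
    fun p hp l h => Nat.sInf_le ⟨p, hp, h⟩
  unfold nearestMessage
  rw [dif_pos ⟨(p, ⟨_, (hmin x hx d hc).trans_lt hd⟩), hp, hl, hmin⟩]
  exact ⟨_, rfl⟩

end Tokens

namespace NodeState

variable {n κ q R : ℕ}

open Classical in
/-- The known sampled nodes about which a sampled node sends messages in round `i` of the second
phase. -/
noncomputable def partners (st : NodeState n κ q R) (i : ℕ) : Finset (Fin n) :=
  Finset.univ.filter fun p => st.seed.1.val = 0 ∧ p ∈ st.sampled ∧ st.id < p ∧ p.val % q = i

lemma mem_partners {st : NodeState n κ q R} {i : ℕ} {p : Fin n} : p ∈ st.partners i ↔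
    st.seed.1.val = 0 ∧ p ∈ st.sampled ∧ st.id < p ∧ p.val % q = i := by
  simp [partners]

/-- The `j`-th message to be spread in the third phase. -/
noncomputable def slot (st : NodeState n κ q R) : ℕ → Option (Message (bits n κ))
  | 0 => nearestMessage κ st.known st.sampled st.id
  | j + 1 => st.held[j]?

end NodeState

section

variable (n κ q h γ : ℕ) [NeZero n] [NeZero q]

/-- Four phases: `h` rounds of local flooding; `q` rounds in which the sampled nodes distribute the
distances between nearby sampled nodes evenly among all nodes; `(γ + 1) * h` rounds in which each
node sends the messages it holds, and one about its nearest sampled node, to random targets; and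
again `h` rounds of local flooding. The local flooding goes on all the time. -/
noncomputable def apspAlgorithm : Algorithm n (bits n κ) γ where
  Seed := Seed n q ((γ + 1) * h)
  State := NodeState n κ q ((γ + 1) * h)
  LocalMsg := Set (Fact n) × Set (Fin n)
  init v view seed :=
    { clock := 0
      id := v
      seed := seed
      known := {f | f.1 = v ∧ view f.2.1 = some f.2.2}
      sampled := {p | p = v ∧ seed.1.val = 0}
      held := [] }
  localSend st _ := (st.known, st.sampled)
  globalSend st j :=
    if st.clock < h then none
    else if st.clock < h + q then
      (st.partners (st.clock - h)).toList[j.val]?.bind fun p =>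
        -- Addition in `Fin n` is modulo n: each target is responsible for the pairs with one
        -- particular sum.
        (pairMessage κ st.known st.id p).map fun m => (st.id + p, m)
    -- Only one message per node and round in this phase, so that the load of a target is that of n
    -- balls thrown into n bins.
    else if hr : st.clock - (h + q) < (γ + 1) * h ∧ j.val = 0 then
      (st.slot ((st.clock - (h + q)) / h)).map fun m =>
        (st.seed.2 ⟨st.clock - (h + q), hr.1⟩, m)
    else none
  update st inbox recv :=
    { clock := st.clock + 1
      id := st.id
      seed := st.seed
      known := st.known ∪ {f | ∃ u m, inbox u = some m ∧ f ∈ m.1} ∪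
        {f | ∃ x ∈ recv, f ∈ decode x.2}
      sampled := st.sampled ∪ {p | ∃ u m, inbox u = some m ∧ p ∈ m.2}
      -- The list is frozen after the second phase, so its slots stay fixed; later messages enter
      -- only `known`.
      held := if st.clock < h + q then st.held ++ (recv.map Prod.snd).toList else st.held }
  output st v := sInf {l | Chain st.known st.id v l}

/-- The total number of rounds. -/
def rounds (q h γ : ℕ) : ℕ := h + q + (γ + 1) * h + h

variable {n κ q h γ}

/-- The outcomes of the randomness for which the algorithm succeeds. -/
structure GoodSeeds {G : WeightedGraph n} (hG : G.graph.Connected)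
    (ω : Fin n → Seed n q ((γ + 1) * h)) : Prop where
  path : ∀ u v, (G.geodesic hG u v).length ≤ h ∨
    ∃ i, 1 ≤ i ∧ i ≤ h ∧ (ω ((G.geodesic hG u v).getVert i)).1.val = 0
  pair : ∀ w, (Finset.univ.filter fun p : Fin n =>
    (ω p).1.val = 0 ∧ (ω (w - p)).1.val = 0 ∧ p < w - p).card ≤ γ
  residue : ∀ i, (Finset.univ.filter fun p : Fin n =>
    (ω p).1.val = 0 ∧ p.val % q = i).card ≤ γ
  target : ∀ r v, (Finset.univ.filter fun w => (ω w).2 r = v).card ≤ γ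
  -- The rounds r with r / h = j are the h rounds devoted to slot j.
  cover : ∀ u w j, j ≤ γ → ∃ r, r.val / h = j ∧ G.graph.dist u ((ω w).2 r) ≤ h

end

/-! ### Counting addressed messages, and soundness of facts -/

lemma card_filterMap_le {α β : Type*} (f : α → Option β) (s : Multiset α) :
    (s.filterMap f).card = (s.filter fun a => (f a).isSome).card := by
  induction s using Multiset.induction_on with
  | empty => simp
  | cons a s ih =>
    cases hf : f a with
    | none => rw [Multiset.filterMap_cons_none _ _ hf, Multiset.filter_cons_of_neg _ (by simp [hf]), ih]
    | some b =>
      rw [Multiset.filterMap_cons_some _ _ _ hf, Multiset.filter_cons_of_pos _ (by simp [hf]),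
        Multiset.card_cons, Multiset.card_cons, ih]

namespace Algorithm

lemma mem_addressed {n b γ : ℕ} (A : Algorithm n b γ) (s : Fin n → A.State) (v p : Fin n)
    (m : Message b) : (p, m) ∈ A.addressed s v ↔ ∃ j, A.globalSend (s p) j = some (v, m) := by
  simp only [addressed, Multiset.mem_filterMap, Finset.mem_val, Finset.mem_univ, true_and,
    Prod.exists, Option.bind_eq_some_iff]
  constructor
  · rintro ⟨p', j, w, m', hs, h⟩
    split_ifs at h with hw
    simp only [Option.some.injEq, Prod.mk.injEq] at h
    obtain ⟨rfl, rfl⟩ := h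
    exact ⟨j, by rw [hs, ← hw]⟩
  · rintro ⟨j, hj⟩
    exact ⟨p, j, v, m, hj, by simp⟩

/-- When no sender uses two of its message slots for the same target, the messages addressed to v
inject into their senders. -/
lemma addressed_card_le {n b γ : ℕ} (A : Algorithm n b γ) (s : Fin n → A.State) (v : Fin n)
    (X : Finset (Fin n)) (hX : ∀ p j m, A.globalSend (s p) j = some (v, m) → p ∈ X)
    (hj : ∀ p j j' m m', A.globalSend (s p) j = some (v, m) →
      A.globalSend (s p) j' = some (v, m') → j = j') :
    (A.addressed s v).card ≤ X.card := by
  classical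
  unfold addressed
  rw [card_filterMap_le]
  have key : ∀ x : Fin n × Fin γ, ((A.globalSend (s x.1) x.2).bind fun tm =>
      if tm.1 = v then some (x.1, tm.2) else none).isSome → 
      ∃ m, A.globalSend (s x.1) x.2 = some (v, m) := by
    intro x hx
    obtain ⟨y, hy⟩ := Option.isSome_iff_exists.mp hx
    obtain ⟨tm, htm, h⟩ := Option.bind_eq_some_iff.mp hy
    split_ifs at h with hv
    exact ⟨tm.2, by rw [htm, ← hv]⟩
  change (Finset.univ.filter _).card ≤ _
  refine Finset.card_le_card_of_injOn Prod.fst ?_ ?_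
  · intro x hx
    simp only [Finset.coe_filter, Finset.mem_univ, true_and, Set.mem_ofPred_eq] at hx
    obtain ⟨m, hm⟩ := key x hx
    exact hX _ _ _ hm
  · rintro ⟨p, j⟩ hx ⟨p', j'⟩ hx' rfl
    simp only [Finset.coe_filter, Finset.mem_univ, true_and, Set.mem_ofPred_eq] at hx hx'
    obtain ⟨m, hm⟩ := key (p, j) hx
    obtain ⟨m', hm'⟩ := key (p, j') hx'
    exact Prod.ext rfl (hj _ _ _ _ _ hm hm')

end Algorithm

namespace WeightedGraph

variable {n : ℕ}

/-- A fact is sound if there is such a walk. -/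
def Sound (G : WeightedGraph n) (f : Fact n) : Prop :=
  ∃ p : G.graph.Walk f.1 f.2.1, G.length p = f.2.2

lemma Sound.of_chain {G : WeightedGraph n} {K : Set (Fact n)} (hK : ∀ f ∈ K, G.Sound f)
    {u v : Fin n} {l : ℕ} (hc : Chain K u v l) : G.Sound (u, v, l) := by
  induction hc with
  | refl u => exact ⟨.nil, rfl⟩
  | forward hf _ ih =>
    obtain ⟨p, hp⟩ := hK _ hf
    obtain ⟨r, hr⟩ := ih
    exact ⟨p.append r, by simp_all⟩
  | backward hf _ ih =>
    obtain ⟨p, hp⟩ := hK _ hf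
    obtain ⟨r, hr⟩ := ih
    exact ⟨p.reverse.append r, by simp_all⟩

lemma Sound.natDist_le {G : WeightedGraph n} {u v : Fin n} {l : ℕ} (hs : G.Sound (u, v, l)) :
    G.natDist u v ≤ l := by
  obtain ⟨p, hp⟩ := hs
  exact (WeightedGraph.natDist_le p).trans_eq hp

end WeightedGraph

/-! ### Correctness of every execution with good seeds -/

section Execution

variable {n κ q h γ : ℕ} [NeZero n] [NeZero q] {G : WeightedGraph n}
  {ω : Fin n → Seed n q ((γ + 1) * h)} {s : ℕ → Fin n → NodeState n κ q ((γ + 1) * h)}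

section Sending

variable {st : NodeState n κ q ((γ + 1) * h)} {j : Fin γ} {v : Fin n} {m : Message (bits n κ)}

lemma globalSend_eq_some_iff : (apspAlgorithm n κ q h γ).globalSend st j = some (v, m) ↔
    (h ≤ st.clock ∧ st.clock < h + q ∧ ∃ p, (st.partners (st.clock - h)).toList[j.val]? = some p ∧
      pairMessage κ st.known st.id p = some m ∧ st.id + p = v) ∨
    (h + q ≤ st.clock ∧ ∃ r : Fin ((γ + 1) * h), st.clock = h + q + r ∧ j.val = 0 ∧
      st.slot (r / h) = some m ∧ st.seed.2 r = v) := by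
  change (if st.clock < h then none else _) = some (v, m) ↔ _
  split_ifs with h1 h2 h3
  · simp only [false_iff, not_or]
    exact ⟨by omega, by omega⟩
  · simp only [Option.bind_eq_some_iff, Option.map_eq_some_iff, Prod.mk.injEq]
    constructor
    · rintro ⟨p, hp, m', hm, hv, rfl⟩
      exact .inl ⟨by omega, h2, p, hp, hm, hv⟩
    · rintro (⟨-, -, p, hp, hm, hv⟩ | h')
      · exact ⟨p, hp, m, hm, hv, rfl⟩
      · omega
  · simp only [Option.map_eq_some_iff, Prod.mk.injEq]
    constructor
    · rintro ⟨m', hm, hv, rfl⟩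
      exact .inr ⟨by omega, ⟨_, h3.1⟩, by simp; omega, h3.2, hm, hv⟩
    · rintro (h' | ⟨-, r, hr, hj, hm, hv⟩)
      · omega
      · have : (⟨st.clock - (h + q), h3.1⟩ : Fin _) = r := Fin.ext (by simp; omega)
        refine ⟨m, ?_, ?_, rfl⟩
        · rw [← hm, ← this]
        · rw [← hv, ← this]
  · simp only [false_iff, not_or]
    refine ⟨by omega, ?_⟩
    rintro ⟨-, r, hr, hj, -⟩
    exact h3 ⟨by omega, hj⟩

end Sending

lemma execution_invariants (hs : (apspAlgorithm n κ q h γ).IsExecution G ω s) (t : ℕ) (v : Fin n) :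
    (s t v).clock = t ∧ (s t v).id = v ∧ (s t v).seed = ω v := by
  induction t with
  | zero => rw [hs.init]; exact ⟨rfl, rfl, rfl⟩
  | succ t ih =>
    obtain ⟨recv, -, h⟩ := hs.step t v
    rw [h]
    exact ⟨congrArg (· + 1) ih.1, ih.2⟩

lemma clock_eq (hs : (apspAlgorithm n κ q h γ).IsExecution G ω s) (t : ℕ) (v : Fin n) :
    (s t v).clock = t := (execution_invariants hs t v).1

lemma id_eq (hs : (apspAlgorithm n κ q h γ).IsExecution G ω s) (t : ℕ) (v : Fin n) :
    (s t v).id = v := (execution_invariants hs t v).2.1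

lemma seed_eq (hs : (apspAlgorithm n κ q h γ).IsExecution G ω s) (t : ℕ) (v : Fin n) :
    (s t v).seed = ω v := (execution_invariants hs t v).2.2

lemma localInbox_eq_some {u v : Fin n} {m : Set (Fact n) × Set (Fin n)}
    {s : Fin n → NodeState n κ q ((γ + 1) * h)} :
    (apspAlgorithm n κ q h γ).localInbox G s v u = some m ↔
      G.graph.Adj v u ∧ ((s u).known, (s u).sampled) = m := by
  unfold Algorithm.localInbox
  split_ifs with hadj
  · simp only [hadj, true_and]
    exact Option.some_inj
  · simp [hadj]

/-- One round of an execution. -/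
lemma step (hs : (apspAlgorithm n κ q h γ).IsExecution G ω s) (t : ℕ) (v : Fin n) :
    ∃ recv, Algorithm.Delivery γ ((apspAlgorithm n κ q h γ).addressed (s t) v) recv ∧
      (s (t + 1) v).known = (s t v).known ∪ {f | ∃ u, G.graph.Adj v u ∧ f ∈ (s t u).known} ∪
        {f | ∃ x ∈ recv, f ∈ decode x.2} ∧
      (s (t + 1) v).sampled = (s t v).sampled ∪ {p | ∃ u, G.graph.Adj v u ∧ p ∈ (s t u).sampled} ∧
      (s (t + 1) v).held =
        if t < h + q then (s t v).held ++ (recv.map Prod.snd).toList else (s t v).held := by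
  obtain ⟨recv, hrecv, h⟩ := hs.step t v
  refine ⟨recv, hrecv, ?_⟩
  rw [h]
  refine ⟨?_, ?_, ?_⟩
  · change (s t v).known ∪ {f | ∃ u m, (apspAlgorithm n κ q _ γ).localInbox G (s t) v u = some m ∧
      f ∈ m.1} ∪ _ = _
    congr! 3
    ext f
    constructor
    · rintro ⟨u, m, hm, h2⟩
      obtain ⟨h1, rfl⟩ := localInbox_eq_some.mp hm
      exact ⟨u, h1, h2⟩
    · rintro ⟨u, h1, h2⟩
      exact ⟨u, _, localInbox_eq_some.mpr ⟨h1, rfl⟩, h2⟩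
  · change (s t v).sampled ∪ {f | ∃ u m, (apspAlgorithm n κ q _ γ).localInbox G (s t) v u = some m ∧
      f ∈ m.2} = _
    congr! 2
    ext f
    constructor
    · rintro ⟨u, m, hm, h2⟩
      obtain ⟨h1, rfl⟩ := localInbox_eq_some.mp hm
      exact ⟨u, h1, h2⟩
    · rintro ⟨u, h1, h2⟩
      exact ⟨u, _, localInbox_eq_some.mpr ⟨h1, rfl⟩, h2⟩
  · change (if (s t v).clock < _ then _ else _) = _
    rw [clock_eq hs]

lemma known_succ (hs : (apspAlgorithm n κ q h γ).IsExecution G ω s) (t : ℕ) (v : Fin n) :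
    (s t v).known ⊆ (s (t + 1) v).known := by
  obtain ⟨recv, -, h, -⟩ := step hs t v
  rw [h]
  exact fun f hf => .inl (.inl hf)

lemma sampled_succ (hs : (apspAlgorithm n κ q h γ).IsExecution G ω s) (t : ℕ) (v : Fin n) :
    (s t v).sampled ⊆ (s (t + 1) v).sampled := by
  obtain ⟨recv, -, -, h, -⟩ := step hs t v
  rw [h]
  exact fun f hf => .inl hf

lemma known_mono (hs : (apspAlgorithm n κ q h γ).IsExecution G ω s) (v : Fin n) :
    Monotone fun t => (s t v).known := monotone_nat_of_le_succ fun t => known_succ hs t v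

lemma sampled_mono (hs : (apspAlgorithm n κ q h γ).IsExecution G ω s) (v : Fin n) :
    Monotone fun t => (s t v).sampled := monotone_nat_of_le_succ fun t => sampled_succ hs t v

/-- Knowledge spreads along walks. -/
lemma spread (hs : (apspAlgorithm n κ q h γ).IsExecution G ω s) {u x : Fin n}
    (p : G.graph.Walk u x) {t t' : ℕ} (ht : t + p.length ≤ t') :
    (s t x).known ⊆ (s t' u).known ∧ (s t x).sampled ⊆ (s t' u).sampled := by
  induction p generalizing t' with
  | nil => exact ⟨known_mono hs _ (by simpa using ht), sampled_mono hs _ (by simpa using ht)⟩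
  | @cons u v x hadj p ih =>
    rw [SimpleGraph.Walk.length_cons] at ht
    obtain ⟨t', rfl⟩ : ∃ k, t' = k + 1 := ⟨t' - 1, by omega⟩
    have := ih (t' := t') (by omega)
    obtain ⟨recv, -, h, h', -⟩ := step hs t' u
    rw [h, h']
    exact ⟨fun f hf => .inl (.inr ⟨v, hadj, this.1 hf⟩), fun f hf => .inr ⟨v, hadj, this.2 hf⟩⟩

/-- After `t` rounds a node knows all walks from it with at most `t` edges. -/
lemma chain_of_walk (hs : (apspAlgorithm n κ q h γ).IsExecution G ω s) {u x : Fin n}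
    (p : G.graph.Walk u x) {t : ℕ} (ht : p.length ≤ t) : Chain (s t u).known u x (G.length p) := by
  induction p generalizing t with
  | nil => exact .refl _
  | @cons u v x hadj p ih =>
    rw [SimpleGraph.Walk.length_cons] at ht
    obtain ⟨t, rfl⟩ : ∃ k, t = k + 1 := ⟨t - 1, by omega⟩
    rw [WeightedGraph.length_cons]
    refine .forward (v := v) ?_ ((ih (t := t) (by omega)).mono
      (spread hs (.cons hadj .nil) (by simp)).1)
    refine known_mono hs u (Nat.zero_le (t + 1)) ?_
    change _ ∈ (s 0 u).known
    rw [hs.init]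
    refine ⟨rfl, ?_⟩
    simp [WeightedGraph.view, hadj]

lemma mem_sampled_of_walk (hs : (apspAlgorithm n κ q h γ).IsExecution G ω s) {u x : Fin n}
    (hx : (ω x).1.val = 0) (p : G.graph.Walk u x) {t : ℕ} (ht : p.length ≤ t) :
    x ∈ (s t u).sampled := by
  refine (spread hs p (t := 0) (by omega)).2 ?_
  rw [hs.init]
  exact ⟨rfl, hx⟩

/-- This is why load bounds can be read off the seeds, whatever a node has learnt: messages of the
second phase only concern pairs that really are sampled. -/
lemma of_mem_sampled (hs : (apspAlgorithm n κ q h γ).IsExecution G ω s) {t : ℕ} {v x : Fin n}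
    (hx : x ∈ (s t v).sampled) : (ω x).1.val = 0 := by
  induction t generalizing v with
  | zero =>
    rw [hs.init] at hx
    obtain ⟨rfl, h⟩ := hx
    exact h
  | succ t ih =>
    obtain ⟨recv, -, -, h, -⟩ := step hs t v
    rw [h] at hx
    obtain hx | ⟨u, -, hx⟩ := hx
    exacts [ih hx, ih hx]

/-- Everything that is known or held is true. -/
lemma sound (hs : (apspAlgorithm n κ q h γ).IsExecution G ω s) (t : ℕ) (v : Fin n) :
    (∀ f ∈ (s t v).known, G.Sound f) ∧ ∀ m ∈ (s t v).held, ∀ f ∈ decode m, G.Sound f := by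
  induction t generalizing v with
  | zero =>
    rw [hs.init]
    refine ⟨?_, by simp [apspAlgorithm]⟩
    rintro ⟨u, w, l⟩ ⟨hu, hf⟩
    obtain rfl : u = v := hu
    unfold WeightedGraph.view at hf
    simp only at hf
    split_ifs at hf with hadj
    exact ⟨.cons hadj .nil, by simpa using hf⟩
  | succ t ih =>
    -- A message either encodes a chain of facts known to its sender or is one that the sender
    -- holds. Since a delivery is a submultiset, soundness needs no bound on congestion.
    have hm : ∀ x ∈ (apspAlgorithm n κ q h γ).addressed (s t) v, ∀ f ∈ decode x.2, G.Sound f := by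
      rintro ⟨p, m⟩ hx
      obtain ⟨j, hj⟩ := (Algorithm.mem_addressed _ _ _ _ _).mp hx
      rw [globalSend_eq_some_iff] at hj
      obtain ⟨-, -, p', -, hm, -⟩ | ⟨-, r, -, -, hm, -⟩ := hj
      · obtain ⟨l, rfl, hc⟩ := pairMessage_eq_some hm
        simp only [mem_decode_code, forall_eq]
        exact .of_chain (ih p).1 hc
      · cases hk : (r : ℕ) / h with
        | zero =>
          rw [hk] at hm
          obtain ⟨p', l, rfl, -, hc, -⟩ := nearestMessage_eq_some hm
          simp only [mem_decode_code, forall_eq]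
          exact .of_chain (ih p).1 hc
        | succ k =>
          rw [hk] at hm
          exact (ih p).2 m (List.mem_of_getElem? hm)
    obtain ⟨recv, hrecv, h1, -, h2⟩ := step hs t v
    refine ⟨?_, ?_⟩
    · rw [h1]
      rintro f ((hf | ⟨u, -, hf⟩) | ⟨x, hx, hf⟩)
      · exact (ih v).1 f hf
      · exact (ih u).1 f hf
      · exact hm x (Multiset.mem_of_le hrecv.1 hx) f hf
    · rw [h2]
      intro m hmem
      split_ifs at hmem
      · simp only [List.mem_append, Multiset.mem_toList, Multiset.mem_map] at hmem
        obtain hmem | ⟨x, hx, rfl⟩ := hmem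
        · exact (ih v).2 m hmem
        · exact hm x (Multiset.mem_of_le hrecv.1 hx)
      · exact (ih v).2 m hmem

lemma natDist_le_of_chain (hs : (apspAlgorithm n κ q h γ).IsExecution G ω s) {t : ℕ}
    {z u v : Fin n} {l : ℕ} (hc : Chain (s t z).known u v l) : G.natDist u v ≤ l :=
  (WeightedGraph.Sound.of_chain (sound hs t z).1 hc).natDist_le

/-- A node is addressed in round `i` of the second phase by few nodes. -/
lemma addressed_card_le_of_lt (hs : (apspAlgorithm n κ q h γ).IsExecution G ω s) {t : ℕ}
    (ht : t < h + q) (v : Fin n) : ((apspAlgorithm n κ q h γ).addressed (s t) v).card ≤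
      (Finset.univ.filter fun p : Fin n => ((ω p).1.val = 0 ∧ (ω (v - p)).1.val = 0 ∧ p < v - p) ∧
        h ≤ t ∧ (v - p).val % q = t - h).card := by
  apply Algorithm.addressed_card_le
  · intro p j m hj
    rw [globalSend_eq_some_iff, clock_eq hs, id_eq hs] at hj
    obtain ⟨h1, h2, p', h3, -, rfl⟩ | h' := hj
    · have := List.mem_of_getElem? h3
      rw [Finset.mem_toList, NodeState.mem_partners, seed_eq hs, id_eq hs] at this
      simp only [Finset.mem_univ, true_and, Finset.mem_filter, add_sub_cancel_left]
      exact ⟨⟨this.1, of_mem_sampled hs this.2.1, this.2.2.1⟩, h1, this.2.2.2⟩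
    · omega
  · intro p j j' m m' hj hj'
    rw [globalSend_eq_some_iff, clock_eq hs, id_eq hs] at hj hj'
    obtain ⟨-, -, p', h3, -, h4⟩ | h' := hj
    · obtain ⟨-, -, p'', h3', -, h4'⟩ | h' := hj'
      · obtain rfl : p' = p'' := add_left_cancel (h4.trans h4'.symm)
        have hnd := ((s t p).partners (t - h)).nodup_toList
        exact Fin.ext ((List.getElem?_inj (List.getElem?_eq_some_iff.mp h3).1 hnd).mp
          (h3.trans h3'.symm))
      · omega
    · omega

/-- No node is addressed by more than `γ` messages in a round. -/
lemma addressed_card_le (hs : (apspAlgorithm n κ q h γ).IsExecution G ω s)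
    {hG : G.graph.Connected} (hω : GoodSeeds hG ω) (t : ℕ) (v : Fin n) :
    ((apspAlgorithm n κ q h γ).addressed (s t) v).card ≤ γ := by
  by_cases ht : t < h + q
  · refine (addressed_card_le_of_lt hs ht v).trans (le_trans ?_ (hω.pair v))
    exact Finset.card_le_card (Finset.monotone_filter_right _ fun p _ hp => hp.1)
  · by_cases hr : t - (h + q) < (γ + 1) * h
    · refine (Algorithm.addressed_card_le _ _ v _ ?_ ?_).trans (hω.target ⟨_, hr⟩ v)
      · intro p j m hj
        rw [globalSend_eq_some_iff, clock_eq hs, seed_eq hs] at hj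
        obtain h' | ⟨-, r, h1, -, -, rfl⟩ := hj
        · omega
        · have : (⟨t - (h + q), hr⟩ : Fin _) = r := Fin.ext (by simp; omega)
          simp [this]
      · intro p j j' m m' hj hj'
        rw [globalSend_eq_some_iff, clock_eq hs] at hj hj'
        obtain h' | ⟨-, r, -, h1, -⟩ := hj
        · omega
        · obtain h' | ⟨-, r', -, h1', -⟩ := hj'
          · omega
          · exact Fin.ext (h1.trans h1'.symm)
    · refine (Algorithm.addressed_card_le _ _ v ∅ ?_ ?_).trans (by simp)
      all_goals
        intro p j
        intros
        rename (apspAlgorithm n κ q h γ).globalSend (s t p) j = some _ => hj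
        rw [globalSend_eq_some_iff, clock_eq hs] at hj
        obtain h' | ⟨-, r, h1, -⟩ := hj <;> omega

/-- Without congestion, everything is delivered. -/
lemma step_delivered (hs : (apspAlgorithm n κ q h γ).IsExecution G ω s)
    {hG : G.graph.Connected} (hω : GoodSeeds hG ω) (t : ℕ) (v : Fin n) :
    {f | ∃ x ∈ (apspAlgorithm n κ q h γ).addressed (s t) v, f ∈ decode x.2} ⊆ (s (t + 1) v).known ∧
      (s (t + 1) v).held = if t < h + q then (s t v).held ++
        (((apspAlgorithm n κ q h γ).addressed (s t) v).map Prod.snd).toList else (s t v).held := by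
  obtain ⟨recv, hrecv, h1, -, h2⟩ := step hs t v
  rw [hrecv.2.2 (addressed_card_le hs hω t v)] at h1 h2
  exact ⟨by rw [h1]; exact Set.subset_union_right, h2⟩

/-- The pair with sum v and smaller element p is announced only in the round given by the residue of
v - p. Different rounds thus contribute disjoint sets of senders, and the total over all q rounds,
not just the load of one round, is bounded by the number of pairs. -/
lemma held_length_le (hs : (apspAlgorithm n κ q h γ).IsExecution G ω s)
    {hG : G.graph.Connected} (hω : GoodSeeds hG ω) (t : ℕ) (v : Fin n) (ht : t ≤ h + q) :
    (s t v).held.length ≤ (Finset.univ.filter fun p : Fin n =>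
      ((ω p).1.val = 0 ∧ (ω (v - p)).1.val = 0 ∧ p < v - p) ∧ h + (v - p).val % q < t).card := by
  induction t with
  | zero =>
    rw [hs.init]
    simp [apspAlgorithm]
  | succ t ih =>
    have h1 := addressed_card_le_of_lt hs (t := t) (by omega) v
    rw [(step_delivered hs hω t v).2, if_pos (by omega), List.length_append, Multiset.length_toList,
      Multiset.card_map]
    refine (add_le_add (ih (by omega)) h1).trans ?_
    rw [← Finset.card_union_of_disjoint]
    · refine Finset.card_le_card fun p hp => ?_
      simp only [Finset.mem_union, Finset.mem_filter, Finset.mem_univ, true_and] at hp ⊢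
      obtain ⟨h1, h2⟩ | ⟨h1, h2, h3⟩ := hp
      · exact ⟨h1, by omega⟩
      · exact ⟨h1, by omega⟩
    · rw [Finset.disjoint_left]
      intro p hp hp'
      simp only [Finset.mem_filter, Finset.mem_univ, true_and] at hp hp'
      omega

lemma held_eq (hs : (apspAlgorithm n κ q h γ).IsExecution G ω s) (v : Fin n) {t : ℕ}
    (ht : h + q ≤ t) : (s t v).held = (s (h + q) v).held := by
  induction t, ht using Nat.le_induction with
  | base => rfl
  | succ t ht ih =>
    obtain ⟨recv, -, -, -, hheld⟩ := step hs t v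
    rw [hheld, if_neg (by omega), ih]

lemma held_prefix (hs : (apspAlgorithm n κ q h γ).IsExecution G ω s) (v : Fin n) {m} {t : ℕ}
    (hm : m ∈ (s t v).held) {t' : ℕ} (ht : t ≤ t') : m ∈ (s t' v).held := by
  induction t', ht using Nat.le_induction with
  | base => exact hm
  | succ t ht ih =>
    obtain ⟨recv, -, -, -, hheld⟩ := step hs t v
    rw [hheld]
    split_ifs <;> simp [ih]

/-- A message that occupies a slot of some node throughout the third phase is received by all. -/
lemma exists_known_of_slot (hs : (apspAlgorithm n κ q h γ).IsExecution G ω s)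
    {hG : G.graph.Connected} (hω : GoodSeeds hG ω) (hγ : 0 < γ) {w : Fin n} {j : ℕ} (hj : j ≤ γ)
    {Φ : Message (bits n κ) → Prop} (hΦ : ∀ t, h + q ≤ t → ∃ m, (s t w).slot j = some m ∧ Φ m)
    (u : Fin n) : ∃ m, Φ m ∧ decode m ⊆ (s (rounds q h γ) u).known := by
  obtain ⟨r, hr, hd⟩ := hω.cover u w j hj
  obtain ⟨m, hm, hm'⟩ := hΦ (h + q + r) (by omega)
  refine ⟨m, hm', fun f hf => ?_⟩
  obtain ⟨p, hp⟩ := hG.exists_walk_length_eq_dist u ((ω w).2 r)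
  have hr' := r.isLt
  refine (spread hs p (t := h + q + r + 1) (by unfold rounds; omega)).1 ?_
  refine (step_delivered hs hω _ _).1 ⟨(w, m), ?_, hf⟩
  refine (Algorithm.mem_addressed _ _ _ _ _).mpr ⟨⟨0, hγ⟩, ?_⟩
  rw [globalSend_eq_some_iff, clock_eq hs, seed_eq hs]
  exact .inr ⟨by omega, r, rfl, rfl, by rw [hr, hm], rfl⟩

/-- The distances between nearby sampled nodes become known to all. -/
lemma pair_known (hs : (apspAlgorithm n κ q h γ).IsExecution G ω s)
    {hG : G.graph.Connected} (hω : GoodSeeds hG ω) (hγ : 0 < γ)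
    (hN : ∀ u v, G.natDist u v < n ^ (κ + 1)) {p p' : Fin n} (hp : (ω p).1.val = 0)
    (hp' : (ω p').1.val = 0) (hlt : p < p') (r : G.graph.Walk p p') (hr : r.length ≤ h)
    (hr' : G.length r = G.natDist p p') (u : Fin n) :
    (p, p', G.natDist p p') ∈ (s (rounds q h γ) u).known := by
  have hq : p'.val % q < q := Nat.mod_lt _ (Nat.pos_of_ne_zero (NeZero.ne q))
  -- The round in which p announces its partner p'; by then flooding has covered h hops.
  set t := h + p'.val % q with ht
  have hsend : pairMessage κ (s t p).known p p' = some (code n κ (p, p', ⟨_, hN p p'⟩)) :=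
    exists_pairMessage _ (hr' ▸ chain_of_walk hs r (by omega)) fun l hl => natDist_le_of_chain hs hl
  have hmem : p' ∈ ((s t p).partners (t - h)).toList := by
    rw [Finset.mem_toList, NodeState.mem_partners, seed_eq hs, id_eq hs]
    exact ⟨hp, mem_sampled_of_walk hs hp' r (by omega), hlt, by omega⟩
  -- All partners in one residue class must fit into the γ global messages of a single round.
  have hcard : ((s t p).partners (t - h)).toList.length ≤ γ := by
    rw [Finset.length_toList]
    refine le_trans (Finset.card_le_card ?_) (hω.residue (t - h))
    intro x hx
    rw [NodeState.mem_partners] at hx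
    simp only [Finset.mem_filter, Finset.mem_univ, true_and]
    exact ⟨of_mem_sampled hs hx.2.1, hx.2.2.2⟩
  obtain ⟨j, hj, hjp⟩ := List.mem_iff_getElem.mp hmem
  have hadd : (p, code n κ (p, p', ⟨_, hN p p'⟩)) ∈
      (apspAlgorithm n κ q h γ).addressed (s t) (p + p') := by
    refine (Algorithm.mem_addressed _ _ _ _ _).mpr ⟨⟨j, by omega⟩, ?_⟩
    rw [globalSend_eq_some_iff, clock_eq hs, id_eq hs]
    exact .inl ⟨by omega, by omega, p', by rw [List.getElem?_eq_getElem hj, hjp], hsend, rfl⟩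
  have hheld : code n κ (p, p', ⟨_, hN p p'⟩) ∈ (s (h + q) (p + p')).held := by
    refine held_prefix hs _ (t := t + 1) ?_ (by omega)
    rw [(step_delivered hs hω _ _).2, if_pos (by omega), List.mem_append, Multiset.mem_toList,
      Multiset.mem_map]
    exact .inr ⟨_, hadd, rfl⟩
  obtain ⟨i, hi, him⟩ := List.mem_iff_getElem.mp hheld
  have hlen : (s (h + q) (p + p')).held.length ≤ γ := by
    refine (held_length_le hs hω _ _ le_rfl).trans (le_trans ?_ (hω.pair (p + p')))
    exact Finset.card_le_card (Finset.monotone_filter_right _ fun p _ hp => hp.1)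
  -- Slot 0 is reserved for the nearest sampled node, so the i-th held message is in slot i + 1 ≤ γ.
  obtain ⟨m, rfl, hm⟩ := exists_known_of_slot hs hω hγ (w := p + p') (j := i + 1) (by omega)
    (Φ := fun m => m = code n κ (p, p', ⟨_, hN p p'⟩)) (fun t ht => ⟨_, by
      rw [NodeState.slot, held_eq hs _ ht, List.getElem?_eq_getElem hi, him], rfl⟩) u
  exact hm (by simp)

/-- Everybody learns a sampled node that is no farther from `v` than a given nearby sampled node. -/
lemma nearest_known (hs : (apspAlgorithm n κ q h γ).IsExecution G ω s)
    {hG : G.graph.Connected} (hω : GoodSeeds hG ω) (hγ : 0 < γ)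
    (hN : ∀ u v, G.natDist u v < n ^ (κ + 1)) {v x : Fin n} (hx : (ω x).1.val = 0)
    (r : G.graph.Walk v x) (hr : r.length ≤ h) (hr' : G.length r = G.natDist v x) (u : Fin n) :
    ∃ p l, (ω p).1.val = 0 ∧ l ≤ G.natDist v x ∧ (v, p, l) ∈ (s (rounds q h γ) u).known := by
  -- The content of slot 0 may change while knowledge still grows; the predicate keeps only what
  -- holds of it in every round of the phase and later.
  obtain ⟨m, ⟨p, l, rfl, hp, hl⟩, hm⟩ := exists_known_of_slot hs hω hγ (w := v) (j := 0) (by omega)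
    (Φ := fun m => ∃ p l, m = code n κ (v, p, l) ∧ (ω p).1.val = 0 ∧ (l : ℕ) ≤ G.natDist v x)
    (fun t ht => by
      have h1 := hr' ▸ chain_of_walk hs r (t := t) (by omega)
      have h2 := mem_sampled_of_walk hs hx r (t := t) (by omega)
      obtain ⟨m, hm⟩ := exists_nearestMessage (hN v x) h2 h1
      refine ⟨m, by rw [NodeState.slot, id_eq hs, hm], ?_⟩
      obtain ⟨p, l, h3, h4, h5, h6⟩ := nearestMessage_eq_some hm
      exact ⟨p, l, h3, of_mem_sampled hs h4, h6 x h2 _ h1⟩) u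
  exact ⟨p, l, hp, hl, hm (by simp)⟩

/-- Everybody learns the exact distances between sampled nodes. -/
lemma chain_sampled (hs : (apspAlgorithm n κ q h γ).IsExecution G ω s)
    {hG : G.graph.Connected} (hω : GoodSeeds hG ω) (hγ : 0 < γ)
    (hN : ∀ u v, G.natDist u v < n ^ (κ + 1)) {p p' : Fin n} (hp : (ω p).1.val = 0)
    (hp' : (ω p').1.val = 0) (u : Fin n) :
    Chain (s (rounds q h γ) u).known p p' (G.natDist p p') := by
  have near : ∀ {p p' : Fin n}, (ω p).1.val = 0 → (ω p').1.val = 0 → ∀ r : G.graph.Walk p p',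
      r.length ≤ h → G.length r = G.natDist p p' →
      Chain (s (rounds q h γ) u).known p p' (G.natDist p p') := by
    intro p p' hp hp' r hr hr'
    rcases lt_trichotomy p p' with hlt | rfl | hlt
    · exact .of_mem (pair_known hs hω hγ hN hp hp' hlt r hr hr' u)
    · have : G.natDist p p = 0 :=
        Nat.le_zero.mp (WeightedGraph.natDist_le (SimpleGraph.Walk.nil : G.graph.Walk p p))
      rw [this]
      exact .refl p
    · rw [WeightedGraph.natDist_comm hG]
      refine .of_mem_symm (pair_known hs hω hγ hN hp' hp hlt r.reverse (by simpa using hr) ?_ u)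
      rw [WeightedGraph.length_reverse, hr', WeightedGraph.natDist_comm hG]
  induction hk : (G.geodesic hG p p').length using Nat.strong_induction_on generalizing p with
  | _ k ih =>
    subst hk
    rcases le_or_gt (G.geodesic hG p p').length h with hle | hgt
    · exact near hp hp' _ hle (WeightedGraph.length_geodesic hG _ _)
    · obtain ⟨i, hi, hih, hx⟩ := (hω.path p p').resolve_left (by omega)
      obtain ⟨⟨r, hr, hr'⟩, hsum, hlt⟩ := WeightedGraph.geodesic_split hG p p' hi (by omega)
      rw [← hsum]
      exact (near hp hx r (by omega) hr').trans (ih _ hlt hx rfl)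

/-- Every node learns its exact distances to the sampled nodes. -/
lemma chain_to_sampled (hs : (apspAlgorithm n κ q h γ).IsExecution G ω s)
    {hG : G.graph.Connected} (hω : GoodSeeds hG ω) (hγ : 0 < γ)
    (hN : ∀ u v, G.natDist u v < n ^ (κ + 1)) {p : Fin n} (hp : (ω p).1.val = 0) (u : Fin n) :
    Chain (s (rounds q h γ) u).known u p (G.natDist u p) := by
  rcases le_or_gt (G.geodesic hG u p).length h with hle | hgt
  · rw [← WeightedGraph.length_geodesic hG]
    exact chain_of_walk hs _ (by unfold rounds; omega)
  · obtain ⟨i, hi, hih, hx⟩ := (hω.path u p).resolve_left (by omega)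
    obtain ⟨⟨r, hr, hr'⟩, hsum, -⟩ := WeightedGraph.geodesic_split hG u p hi (by omega)
    rw [← hsum]
    refine .trans ?_ (chain_sampled hs hω hγ hN hx hp u)
    rw [← hr']
    exact chain_of_walk hs _ (by unfold rounds; omega)

/-- The geodesic is taken from v, not from u, so that the sampled node is near v. The node p
reported by v is at least as close, and the detour through p costs at most twice d(v,p) extra. -/
lemma exists_chain_le (hs : (apspAlgorithm n κ q h γ).IsExecution G ω s)
    {hG : G.graph.Connected} (hω : GoodSeeds hG ω) (hγ : 0 < γ)
    (hN : ∀ u v, G.natDist u v < n ^ (κ + 1)) (u v : Fin n) :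
    ∃ l ≤ 3 * G.natDist u v, Chain (s (rounds q h γ) u).known u v l := by
  rcases le_or_gt (G.geodesic hG v u).length h with hle | hgt
  · refine ⟨_, ?_, chain_of_walk hs (G.geodesic hG v u).reverse (by simp [rounds]; omega)⟩
    rw [WeightedGraph.length_reverse, WeightedGraph.length_geodesic, WeightedGraph.natDist_comm hG]
    omega
  · obtain ⟨i, hi, hih, hx⟩ := (hω.path v u).resolve_left (by omega)
    obtain ⟨⟨r, hr, hr'⟩, hsum, -⟩ := WeightedGraph.geodesic_split hG v u hi (by omega)
    obtain ⟨p, l, hp, hl, hmem⟩ := nearest_known hs hω hγ hN hx r (by omega) hr' u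
    refine ⟨_, ?_, (chain_to_sampled hs hω hγ hN hp u).trans (.of_mem_symm hmem)⟩
    have h1 := WeightedGraph.natDist_triangle hG u v p
    have h2 : G.natDist v p ≤ l := natDist_le_of_chain hs (.of_mem hmem)
    have h3 := WeightedGraph.natDist_comm hG u v
    omega

theorem mem_approxAPSPEvent {hG : G.graph.Connected} (hω : GoodSeeds hG ω) (hγ : 0 < γ)
    (hN : ∀ u v, G.natDist u v < n ^ (κ + 1)) :
    ω ∈ (apspAlgorithm n κ q h γ).approxAPSPEvent G (rounds q h γ) 3 := by
  intro (s : ℕ → Fin n → NodeState n κ q ((γ + 1) * h)) hs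
  refine ⟨fun t _ v => addressed_card_le hs hω t v, fun u v => ?_⟩
  have hout : (apspAlgorithm n κ q h γ).output (s (rounds q h γ) u) v =
      sInf {l | Chain (s (rounds q h γ) u).known u v l} := by
    change sInf {l | Chain _ (s (rounds q h γ) u).id v l} = _
    rw [id_eq hs]
  obtain ⟨l, hl, hc⟩ := exists_chain_le hs hω hγ hN u v
  rw [hout, WeightedGraph.dist_eq_natDist hG]
  constructor
  -- Nonemptiness matters: the infimum of the empty set would be 0.
  · exact_mod_cast natDist_le_of_chain hs (Nat.sInf_mem ⟨l, hc⟩)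
  · exact_mod_cast (Nat.sInf_le hc).trans hl

end Execution

/-! ### Failure probabilities of the conditions on the seeds -/

section Probability

variable {n q h γ : ℕ} [NeZero n] [NeZero q]

lemma frac_forall_sampled {R : ℕ} (J : Finset (Fin n)) :
    frac {ω : Fin n → Seed n q R | ∀ i ∈ J, (ω i).1.val = 0} = (1 / (q : ℝ)) ^ J.card := by
  have h0 : {x : Fin q | x.val = 0} = {0} := by ext x; simp
  have h1 := frac_pi J {x : Seed n q R | x.1 ∈ {x : Fin q | x.val = 0}}
  rw [frac_fst, h0, frac_singleton, Nat.card_fin] at h1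
  rw [← h1]
  congr 1
  ext ω
  simp

lemma frac_forall_not_sampled {R : ℕ} (J : Finset (Fin n)) :
    frac {ω : Fin n → Seed n q R | ∀ i ∈ J, (ω i).1.val ≠ 0} = (1 - 1 / (q : ℝ)) ^ J.card := by
  have h0 : {x : Fin q | x.val ≠ 0} = {0}ᶜ := by ext x; simp
  have h1 := frac_pi J {x : Seed n q R | x.1 ∈ {x : Fin q | x.val ≠ 0}}
  rw [frac_fst, h0, frac_compl, frac_singleton, Nat.card_fin] at h1
  rw [← h1]
  congr 1
  ext ω
  simp

lemma frac_forall_target {R : ℕ} (J : Finset (Fin n)) (r : Fin R) (v : Fin n) :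
    frac {ω : Fin n → Seed n q R | ∀ w ∈ J, (ω w).2 r = v} = (1 / (n : ℝ)) ^ J.card := by
  have h1 := frac_pi J {x : Seed n q R | x.2 ∈ {y : Fin R → Fin n | y r ∈ ({v} : Set (Fin n))}}
  rw [frac_snd, frac_eval, frac_singleton, Nat.card_fin] at h1
  rw [← h1]
  rfl

/-- The vertices at positions 1 to h of a longer geodesic are distinct, hence h independent trials
with success probability 1/q. -/
lemma frac_path {G : WeightedGraph n} (hG : G.graph.Connected) (u v : Fin n) (R : ℕ) :
    frac {ω : Fin n → Seed n q R | ¬ ((G.geodesic hG u v).length ≤ h ∨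
      ∃ i, 1 ≤ i ∧ i ≤ h ∧ (ω ((G.geodesic hG u v).getVert i)).1.val = 0)} ≤
      (1 - 1 / (q : ℝ)) ^ h := by
  set p := G.geodesic hG u v with hp
  rcases le_or_gt p.length h with hle | hgt
  · have h1 : (1 : ℝ) ≤ q := by exact_mod_cast Nat.one_le_iff_ne_zero.mpr (NeZero.ne q)
    have h2 : 1 / (q : ℝ) ≤ 1 := by rw [div_le_one (by positivity)]; exact h1
    simp only [hle, true_or, not_true_eq_false]
    rw [show {_ω : Fin n → Seed n q R | False} = ∅ from rfl]
    simp only [frac, Set.ncard_empty, Nat.cast_zero, zero_div]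
    exact pow_nonneg (by linarith) _
  · have hinj : Set.InjOn p.getVert (Finset.Icc 1 h) := by
      intro i hi j hj hij
      simp only [Finset.coe_Icc, Set.mem_Icc] at hi hj
      exact (WeightedGraph.geodesic_isPath hG u v).getVert_injOn
        (hi.2.trans hgt.le) (hj.2.trans hgt.le) hij
    have hcard : ((Finset.Icc 1 h).image p.getVert).card = h := by
      rw [Finset.card_image_of_injOn hinj, Nat.card_Icc, Nat.add_sub_cancel]
    refine (frac_mono ?_).trans_eq ((frac_forall_not_sampled (R := R)
      ((Finset.Icc 1 h).image p.getVert)).trans (by rw [hcard]))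
    intro ω hω
    simp only [Set.mem_ofPred_eq, not_or, not_exists, not_and] at hω
    simp only [Set.mem_ofPred_eq, Finset.mem_image, Finset.mem_Icc, forall_exists_index, and_imp]
    rintro _ i hi hi' rfl
    exact hω.2 i hi hi'

/-- The order p < w - p keeps a set J of smaller elements disjoint from its reflection w - J. Hence
|J| pairs involve 2|J| independent coordinates and are all sampled with probability (1/q²)^|J|,
while there are at most n ≤ q² candidates. -/
lemma frac_pair (hq : n ≤ q * q) (w : Fin n) (R : ℕ) :
    frac {ω : Fin n → Seed n q R | ¬ (Finset.univ.filter fun p : Fin n =>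
      (ω p).1.val = 0 ∧ (ω (w - p)).1.val = 0 ∧ p < w - p).card ≤ γ} ≤
      1 / ((γ + 1).factorial : ℝ) := by
  have hq0 : (0 : ℝ) < q := by exact_mod_cast Nat.pos_of_ne_zero (NeZero.ne q)
  refine (frac_mono ?_).trans (frac_exists_card_eq_le (Finset.univ.filter fun p : Fin n => p < w - p)
    (fun p => {ω : Fin n → Seed n q R | (ω p).1.val = 0 ∧ (ω (w - p)).1.val = 0}) (γ + 1)
    (ρ := (1 / (q : ℝ)) ^ 2) (by positivity) ?_ ?_)
  · intro ω hω
    obtain ⟨J, hJ, hc⟩ := Finset.exists_subset_card_eq (not_le.mp hω)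
    refine ⟨J, fun p hp => ?_, hc, fun p hp => ?_⟩
    · have := (Finset.mem_filter.mp (hJ hp)).2
      simpa using this.2.2
    · have := (Finset.mem_filter.mp (hJ hp)).2
      exact ⟨this.1, this.2.1⟩
  · have h1 : ((Finset.univ.filter fun p : Fin n => p < w - p).card : ℝ) ≤ (q : ℝ) ^ 2 := by
      rw [sq]
      exact_mod_cast (Finset.card_le_univ _).trans (by simpa using hq)
    rw [div_pow, one_pow, mul_one_div, div_le_one (by positivity)]
    exact h1
  · intro J hJ hc
    have hinj : Function.Injective fun p : Fin n => w - p := sub_right_injective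
    have hdisj : Disjoint J (J.image fun p => w - p) := by
      rw [Finset.disjoint_left]
      intro p hp hp'
      obtain ⟨p', hp'', rfl⟩ := Finset.mem_image.mp hp'
      have h1 := (Finset.mem_filter.mp (hJ hp)).2
      have h2 := (Finset.mem_filter.mp (hJ hp'')).2
      rw [sub_sub_cancel] at h1
      exact absurd h1 h2.asymm
    have := frac_forall_sampled (q := q) (R := R) (J ∪ J.image fun p => w - p)
    rw [Finset.card_union_of_disjoint hdisj, Finset.card_image_of_injective _ hinj, hc, ← two_mul,
      pow_mul] at this
    rw [← this]
    refine frac_mono fun ω hω i hi => ?_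
    obtain hi | hi := Finset.mem_union.mp hi
    · exact (hω i hi).1
    · obtain ⟨p, hp, rfl⟩ := Finset.mem_image.mp hi
      exact (hω p hp).2

/-- As n ≤ q², the quotient by q embeds a residue class into q values, so at most one sampled node
per class is expected. -/
lemma frac_residue (hq : n ≤ q * q) (i : ℕ) (R : ℕ) :
    frac {ω : Fin n → Seed n q R | ¬ (Finset.univ.filter fun p : Fin n =>
      (ω p).1.val = 0 ∧ p.val % q = i).card ≤ γ} ≤ 1 / ((γ + 1).factorial : ℝ) := by
  have hq0 : (0 : ℝ) < q := by exact_mod_cast Nat.pos_of_ne_zero (NeZero.ne q)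
  refine (frac_mono ?_).trans (frac_exists_card_eq_le
    (Finset.univ.filter fun p : Fin n => p.val % q = i)
    (fun p => {ω : Fin n → Seed n q R | (ω p).1.val = 0}) (γ + 1)
    (ρ := 1 / (q : ℝ)) (by positivity) ?_ ?_)
  · intro ω hω
    obtain ⟨J, hJ, hc⟩ := Finset.exists_subset_card_eq (not_le.mp hω)
    refine ⟨J, fun p hp => ?_, hc, fun p hp => ?_⟩
    · have := (Finset.mem_filter.mp (hJ hp)).2
      simpa using this.2
    · exact (Finset.mem_filter.mp (hJ hp)).2.1
  · have h1 : (Finset.univ.filter fun p : Fin n => p.val % q = i).card ≤ q := by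
      conv_rhs => rw [← Finset.card_range q]
      refine Finset.card_le_card_of_injOn (fun p => p.val / q) ?_ ?_
      · intro p _
        simp only [Finset.coe_range, Set.mem_Iio]
        exact Nat.div_lt_of_lt_mul (p.isLt.trans_le hq)
      · intro p hp p' hp' heq
        simp only [Finset.coe_filter, Finset.mem_univ, true_and, Set.mem_ofPred_eq] at hp hp' heq
        rw [Fin.ext_iff, ← Nat.div_add_mod p.val q, ← Nat.div_add_mod p'.val q, heq, hp, hp']
    rw [mul_one_div, div_le_one hq0]
    exact_mod_cast h1
  · intro J _ hc
    rw [← hc]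
    exact (frac_forall_sampled J).le

lemma frac_target {R : ℕ} (r : Fin R) (v : Fin n) :
    frac {ω : Fin n → Seed n q R | ¬ (Finset.univ.filter fun w => (ω w).2 r = v).card ≤ γ} ≤
      1 / ((γ + 1).factorial : ℝ) := by
  have hn0 : (0 : ℝ) < n := by exact_mod_cast Nat.pos_of_ne_zero (NeZero.ne n)
  refine (frac_mono ?_).trans (frac_exists_card_eq_le Finset.univ
    (fun w => {ω : Fin n → Seed n q R | (ω w).2 r = v}) (γ + 1)
    (ρ := 1 / (n : ℝ)) (by positivity) ?_ ?_)
  · intro ω hω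
    obtain ⟨J, hJ, hc⟩ := Finset.exists_subset_card_eq (not_le.mp hω)
    exact ⟨J, J.subset_univ, hc, fun p hp => (Finset.mem_filter.mp (hJ hp)).2⟩
  · rw [mul_one_div, div_le_one hn0]
    simp
  · intro J _ hc
    rw [← hc]
    exact (frac_forall_target J r v).le

/-- Each of the h rounds of slot j independently hits the ball around u with probability at least
q/n ≥ 1/q. -/
lemma frac_cover {G : WeightedGraph n} (hG : G.graph.Connected) (hq : n ≤ q * q) (hqn : q ≤ n)
    (hqh : q ≤ h) (u w : Fin n) {j : ℕ} (hj : j ≤ γ) :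
    frac {ω : Fin n → Seed n q ((γ + 1) * h) |
      ¬ ∃ r, r.val / h = j ∧ G.graph.dist u ((ω w).2 r) ≤ h} ≤ (1 - 1 / (q : ℝ)) ^ h := by
  have hq0 : (0 : ℝ) < q := by exact_mod_cast Nat.pos_of_ne_zero (NeZero.ne q)
  have hn0 : (0 : ℝ) < n := by exact_mod_cast Nat.pos_of_ne_zero (NeZero.ne n)
  have hh0 : 0 < h := (Nat.pos_of_ne_zero (NeZero.ne q)).trans_le hqh
  set A : Set (Fin n) := {x | G.graph.dist u x ≤ h}
  have hA : 1 / (q : ℝ) ≤ frac A := by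
    have h1 : q ≤ A.ncard := by
      refine (le_trans ?_ (WeightedGraph.card_ball hG u h)).trans_eq ?_
      · exact le_min hqn (by omega)
      · rw [← Set.ncard_coe_finset]
        simp [A]
    rw [frac, Nat.card_fin, div_le_div_iff₀ hq0 hn0, one_mul]
    calc (n : ℝ) ≤ q * q := by exact_mod_cast hq
      _ ≤ A.ncard * q := by gcongr
  have hA1 : frac Aᶜ ≤ 1 - 1 / (q : ℝ) := by rw [frac_compl]; linarith
  set J : Finset (Fin ((γ + 1) * h)) := Finset.univ.filter fun r => r.val / h = j
  have hJ : h ≤ J.card := by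
    conv_lhs => rw [← Fintype.card_fin h, ← Finset.card_univ]
    have hlt : ∀ k : Fin h, j * h + k.val < (γ + 1) * h := fun k => by
      calc j * h + k.val < j * h + h := by omega
        _ = (j + 1) * h := by ring
        _ ≤ (γ + 1) * h := by gcongr
    refine Finset.card_le_card_of_injOn (fun k => ⟨j * h + k.val, hlt k⟩) ?_ ?_
    · intro k _
      simp only [J, Finset.coe_filter, Finset.mem_univ, true_and, Set.mem_ofPred_eq]
      rw [mul_comm, Nat.mul_add_div hh0, Nat.div_eq_of_lt k.isLt, add_zero]
    · intro k _ k' _ heq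
      simpa [Fin.ext_iff] using heq
  have hset : {ω : Fin n → Seed n q ((γ + 1) * h) |
      ¬ ∃ r, r.val / h = j ∧ G.graph.dist u ((ω w).2 r) ≤ h} =
      {ω | ω w ∈ {x : Seed n q ((γ + 1) * h) | x.2 ∈ {y : Fin ((γ + 1) * h) → Fin n |
        ∀ r ∈ J, y r ∈ Aᶜ}}} := by
    ext ω
    simp [A, J]
  rw [hset, frac_eval, frac_snd, frac_pi]
  calc frac Aᶜ ^ J.card ≤ frac Aᶜ ^ h := by
        refine pow_le_pow_of_le_one (frac_nonneg _) (hA1.trans ?_) hJ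
        have : 0 ≤ 1 / (q : ℝ) := by positivity
        linarith
    _ ≤ _ := pow_le_pow_left₀ (frac_nonneg _) hA1 h

/-- A bound for the probability that the algorithm fails. -/
lemma frac_not_goodSeeds_le {G : WeightedGraph n} (hG : G.graph.Connected) (hq : n ≤ q * q)
    (hqn : q ≤ n) (hqh : q ≤ h) :
    frac {ω : Fin n → Seed n q ((γ + 1) * h) | GoodSeeds hG ω}ᶜ ≤
      (n * n + n * n * (γ + 1)) * (1 - 1 / (q : ℝ)) ^ h +
      (n + q + (γ + 1) * h * n) * (1 / ((γ + 1).factorial : ℝ)) := by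
  have h1 := frac_iUnion_le_card_mul _ fun x : Fin n × Fin n =>
    frac_path (q := q) (h := h) hG x.1 x.2 ((γ + 1) * h)
  have h2 := frac_iUnion_le_card_mul _ fun w : Fin n => frac_pair (γ := γ) hq w ((γ + 1) * h)
  have h3 := frac_iUnion_le_card_mul _ fun i : Fin q =>
    frac_residue (γ := γ) hq i.val ((γ + 1) * h)
  have h4 := frac_iUnion_le_card_mul _ fun x : Fin ((γ + 1) * h) × Fin n =>
    frac_target (q := q) (γ := γ) x.1 x.2
  have h5 := frac_iUnion_le_card_mul _ fun x : (Fin n × Fin n) × Fin (γ + 1) =>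
    frac_cover hG hq hqn hqh x.1.1 x.1.2 (Nat.lt_succ_iff.mp x.2.isLt)
  simp only [Fintype.card_prod, Fintype.card_fin, Nat.cast_mul, Nat.cast_add, Nat.cast_one]
    at h1 h2 h3 h4 h5
  refine (frac_mono fun ω hω => ?_).trans (((frac_union_le _ _).trans (add_le_add h1
    ((frac_union_le _ _).trans (add_le_add h2 ((frac_union_le _ _).trans (add_le_add h3
    ((frac_union_le _ _).trans (add_le_add h4 h5)))))))).trans_eq (by ring))
  by_contra hcon
  simp only [Set.mem_union, not_or, Set.mem_iUnion, not_exists, Set.mem_ofPred_eq] at hcon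
  obtain ⟨c1, c2, c3, c4, c5⟩ := hcon
  refine hω ⟨fun u v => ?_, fun w => not_not.mp (c2 w), fun i => ?_,
    fun r v => not_not.mp (c4 (r, v)), fun u w j hj => ?_⟩
  · by_contra hc
    exact c1 (u, v) (by simpa using hc)
  -- The union bound covers the residues below q; all other classes are empty.
  · by_cases hi : i < q
    · exact not_not.mp (c3 ⟨i, hi⟩)
    · rw [Finset.filter_false_of_mem]
      · simp
      · rintro p - ⟨-, hp⟩
        exact hi (hp ▸ Nat.mod_lt _ (Nat.pos_of_ne_zero (NeZero.ne q)))
  · by_contra hc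
    exact c5 ((u, w), ⟨j, Nat.lt_succ_of_le hj⟩) (by simpa using hc)

end Probability

/-! ### Growth estimates -/

section Asymptotics

open Filter

lemma one_sub_one_div_pow_le {q L : ℕ} {n : ℕ} {e : ℝ} (hn : 0 < n) (hq : 0 < q)
    (hL : e * Real.log n ≤ L) : (1 - 1 / (q : ℝ)) ^ (q * L) ≤ 1 / (n : ℝ) ^ e := by
  have hn0 : (0 : ℝ) < n := by exact_mod_cast hn
  have hq1 : (1 : ℝ) ≤ q := by exact_mod_cast hq
  have h1 : 0 ≤ 1 - 1 / (q : ℝ) := by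
    rw [sub_nonneg, div_le_one (by linarith)]
    exact hq1
  calc (1 - 1 / (q : ℝ)) ^ (q * L) ≤ Real.exp (-(1 / (q : ℝ))) ^ (q * L) :=
        pow_le_pow_left₀ h1 (Real.one_sub_le_exp_neg _) _
    _ = Real.exp (-L) := by
        rw [← Real.exp_nat_mul]
        push_cast
        field_simp
    _ ≤ Real.exp (-(e * Real.log n)) := Real.exp_le_exp.mpr (by linarith)
    _ = 1 / (n : ℝ) ^ e := by
        rw [Real.exp_neg, Real.rpow_def_of_pos hn0, one_div, mul_comm e]

/-- The factorial of a logarithm grows faster than any polynomial. -/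
lemma eventually_rpow_le_factorial {a : ℝ} (ha : 0 < a) (e : ℝ) :
    ∀ᶠ n : ℕ in atTop, (n : ℝ) ^ e ≤ ((⌈a * Real.log n⌉₊ + 1).factorial : ℝ) := by
  -- Chosen so that y^m ≥ n^(|e|+1) as soon as m ≥ a ln n. Since y is constant, y^m / m! ≤ exp y ≤ n
  -- for large n, and one factor n cancels.
  set y : ℝ := Real.exp ((|e| + 1) / a) with hy
  have hy1 : 1 ≤ y := Real.one_le_exp (by positivity)
  filter_upwards [eventually_ge_atTop 1, tendsto_natCast_atTop_atTop.eventually_ge_atTop (Real.exp y)]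
    with n hn hny
  have hn0 : (0 : ℝ) < n := by exact_mod_cast hn
  have hn1 : (1 : ℝ) ≤ n := by exact_mod_cast hn
  set m := ⌈a * Real.log n⌉₊ + 1
  have hm : a * Real.log n ≤ (m : ℝ) := by
    refine (Nat.le_ceil _).trans ?_
    simp [m]
  have h1 : (n : ℝ) ^ (|e| + 1) ≤ y ^ m := by
    rw [← Real.rpow_natCast, hy, ← Real.exp_mul, Real.rpow_def_of_pos hn0, Real.exp_le_exp,
      div_mul_eq_mul_div, le_div_iff₀ ha]
    have : 0 ≤ |e| + 1 := by positivity
    nlinarith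
  have h2 := Real.pow_div_factorial_le_exp y (by linarith) m
  rw [div_le_iff₀ (by positivity)] at h2
  have h3 : (n : ℝ) ^ |e| * n ≤ n * (m.factorial : ℝ) := by
    rw [← Real.rpow_add_one hn0.ne']
    exact h1.trans (h2.trans (by gcongr))
  calc (n : ℝ) ^ e ≤ (n : ℝ) ^ |e| := Real.rpow_le_rpow_of_exponent_le hn1 (le_abs_self e)
    _ ≤ m.factorial := by
      rw [mul_comm] at h3
      exact le_of_mul_le_mul_left h3 hn0

lemma eventually_mul_log_le (M : ℝ) : ∀ᶠ n : ℕ in atTop, M * Real.log n ≤ n := by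
  have h : ∀ᶠ x : ℝ in atTop, M * Real.log x ≤ x := by
    have hM : (0 : ℝ) < 1 / (|M| + 1) := by positivity
    filter_upwards [Real.isLittleO_log_id_atTop.bound hM, eventually_ge_atTop 1] with x hx hx1
    have h1 := Real.log_nonneg hx1
    rw [id, Real.norm_of_nonneg h1, Real.norm_of_nonneg (by linarith), one_div,
      ← div_eq_inv_mul, le_div_iff₀ (by positivity)] at hx
    nlinarith [le_abs_self M]
  exact tendsto_natCast_atTop_atTop.eventually h

end Asymptotics

/-! ### Choice of parameters and conclusion -/

/-- An algorithm that does nothing. -/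
def idleAlgorithm (n b γ : ℕ) : Algorithm n b γ where
  Seed := Unit
  State := Unit
  LocalMsg := Unit
  init _ _ _ := ()
  localSend _ _ := ()
  globalSend _ _ := none
  update _ _ _ := ()
  output _ _ := 0

/-- The number of rounds of the first phase. -/
noncomputable def phaseLength (c : ℝ) (n : ℕ) : ℕ := (n.sqrt + 1) * ⌈(c + 5) * Real.log n⌉₊

/-- The algorithm for each number of nodes. -/
noncomputable def approxAPSP (κ : ℕ) (a c : ℝ) (n : ℕ) :
    Algorithm n (bits n κ) ⌈a * Real.log n⌉₊ :=
  if h : n = 0 then idleAlgorithm n _ _ else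
    haveI : NeZero n := ⟨h⟩
    apspAlgorithm n κ (n.sqrt + 1) (phaseLength c n) ⌈a * Real.log n⌉₊

lemma approxAPSP_eq (κ : ℕ) (a c : ℝ) (n : ℕ) [NeZero n] : approxAPSP κ a c n =
    apspAlgorithm n κ (n.sqrt + 1) (phaseLength c n) ⌈a * Real.log n⌉₊ :=
  dif_neg (NeZero.ne n)

/-- With γ + 1 ≤ n and h ≤ n², there are at most n² + n³ events of probability at most n^(-c-5) and
2n + n⁴ events of probability at most n^(-c-6). The spare powers of n absorb the constants once n ≥
3. -/
lemma apspAlgorithm_prob_ge {κ n : ℕ} [NeZero n] {a c : ℝ} (hc : 0 < c)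
    (hn : 3 ≤ n) (hlog : 1 ≤ Real.log n) (hpoly : (a + c + 7) * Real.log n ≤ n) (ha : 0 < a)
    (hfac : (n : ℝ) ^ (c + 6) ≤ ((⌈a * Real.log n⌉₊ + 1).factorial : ℝ))
    {G : WeightedGraph n} (hG : G.graph.Connected)
    (hW : ∀ e ∈ G.graph.edgeSet, G.weight e ≤ n ^ κ) :
    1 - 1 / (n : ℝ) ^ c ≤
      (apspAlgorithm n κ (n.sqrt + 1) (phaseLength c n) ⌈a * Real.log n⌉₊).prob
        ((apspAlgorithm n κ (n.sqrt + 1) (phaseLength c n) ⌈a * Real.log n⌉₊).approxAPSPEvent G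
          (rounds (n.sqrt + 1) (phaseLength c n) ⌈a * Real.log n⌉₊) 3) := by
  set q := n.sqrt + 1
  set L := ⌈(c + 5) * Real.log n⌉₊
  set γ := ⌈a * Real.log n⌉₊
  have hh : phaseLength c n = q * L := rfl
  set h := phaseLength c n
  have hn0 : (0 : ℝ) < n := by positivity
  have hn3 : (3 : ℝ) ≤ n := by exact_mod_cast hn
  have hγ0 : 0 < γ := Nat.ceil_pos.mpr (by positivity)
  have hL0 : 0 < L := Nat.ceil_pos.mpr (by positivity)
  have hqq : n ≤ q * q := (Nat.lt_succ_sqrt n).le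
  have hqn : q ≤ n := Nat.sqrt_lt_self (by omega)
  have hqh : q ≤ h := hh ▸ Nat.le_mul_of_pos_right q hL0
  have hLn : (L : ℝ) ≤ n := by
    have := (Nat.ceil_lt_add_one (a := (c + 5) * Real.log n) (by positivity)).le
    nlinarith
  have hγn : (γ : ℝ) + 1 ≤ n := by
    have := (Nat.ceil_lt_add_one (a := a * Real.log n) (by positivity)).le
    nlinarith
  have hqn' : (q : ℝ) ≤ n := by exact_mod_cast hqn
  have hhn : (h : ℝ) ≤ n * n := by
    rw [hh]
    push_cast
    gcongr
  have hmain := frac_not_goodSeeds_le (γ := γ) hG hqq hqn hqh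
  have hx : (1 - 1 / (q : ℝ)) ^ h ≤ 1 / ((n : ℝ) ^ c * n ^ 5) := by
    have h1 := one_sub_one_div_pow_le (n := n) (q := q) (by omega) (by omega)
      (Nat.le_ceil ((c + 5) * Real.log n))
    rw [hh]
    refine h1.trans_eq ?_
    rw [← Real.rpow_natCast, ← Real.rpow_add hn0]
    norm_num
  have hy : 1 / ((γ + 1).factorial : ℝ) ≤ 1 / ((n : ℝ) ^ c * n ^ 6) := by
    have h1 : (n : ℝ) ^ c * n ^ 6 = (n : ℝ) ^ (c + 6) := by
      rw [← Real.rpow_natCast, ← Real.rpow_add hn0]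
      norm_num
    rw [h1]
    exact one_div_le_one_div_of_le (by positivity) hfac
  have hfail : frac {ω : Fin n → Seed n q ((γ + 1) * h) | GoodSeeds hG ω}ᶜ ≤ 1 / (n : ℝ) ^ c := by
    set P := (n : ℝ) ^ c
    have hP : 0 < P := by positivity
    have hx0 : 0 ≤ (1 - 1 / (q : ℝ)) ^ h := by
      refine pow_nonneg ?_ _
      rw [sub_nonneg, div_le_one (by positivity)]
      exact_mod_cast Nat.succ_le_succ (Nat.zero_le _)
    calc frac {ω : Fin n → Seed n q ((γ + 1) * h) | GoodSeeds hG ω}ᶜ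
        ≤ (n * n + n * n * (γ + 1)) * (1 - 1 / (q : ℝ)) ^ h +
          (n + q + (γ + 1) * h * n) * (1 / ((γ + 1).factorial : ℝ)) := hmain
      _ ≤ (n * n + n * n * n) * (1 / (P * n ^ 5)) +
          (n + n + n * (n * n) * n) * (1 / (P * n ^ 6)) := by gcongr
      _ = (2 * (n : ℝ) ^ 3 + n ^ 2 + 2) / n ^ 5 * (1 / P) := by
          field_simp
          ring
      _ ≤ 1 * (1 / P) := by
          gcongr
          rw [div_le_one (by positivity)]
          have h2 : (9 : ℝ) ≤ n ^ 2 := by nlinarith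
          have h3 : (n : ℝ) ^ 2 ≤ n ^ 3 := pow_le_pow_right₀ (by linarith) (by norm_num)
          have h5 : (n : ℝ) ^ 3 * 9 ≤ n ^ 3 * n ^ 2 := by gcongr
          have h6 : (n : ℝ) ^ 5 = n ^ 3 * n ^ 2 := by ring
          linarith
      _ = 1 / P := one_mul _
  have hgood := one_sub_frac_compl_le {ω : Fin n → Seed n q ((γ + 1) * h) | GoodSeeds hG ω}
  calc 1 - 1 / (n : ℝ) ^ c ≤ frac {ω : Fin n → Seed n q ((γ + 1) * h) | GoodSeeds hG ω} := by
        linarith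
    _ ≤ _ := frac_mono fun ω hω =>
        mem_approxAPSPEvent hω hγ0 (WeightedGraph.natDist_lt hG (by omega) hW)

/-- The total is qL(γ + 3) + q. As ln n ≥ 1, the rounding terms are absorbed into L ≤ (c + 6) ln n
and γ + 3 ≤ (a + 4) ln n. -/
lemma rounds_le {n : ℕ} {a c : ℝ} (ha : 0 < a) (hc : 0 < c) (hn : 3 ≤ n)
    (hlog : 1 ≤ Real.log n) :
    (rounds (n.sqrt + 1) (phaseLength c n) ⌈a * Real.log n⌉₊ : ℝ) ≤
      (2 * (c + 6) * (a + 4) + 2) * √(n : ℝ) * Real.log n ^ 2 := by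
  have hL := (Nat.ceil_lt_add_one (a := (c + 5) * Real.log n) (by positivity)).le
  have hγ := (Nat.ceil_lt_add_one (a := a * Real.log n) (by positivity)).le
  unfold rounds phaseLength
  set L := ⌈(c + 5) * Real.log n⌉₊
  set γ := ⌈a * Real.log n⌉₊
  have hq : ((n.sqrt + 1 : ℕ) : ℝ) ≤ 2 * √(n : ℝ) := by
    have h1 := Real.nat_sqrt_le_real_sqrt (a := n)
    have h2 : (1 : ℝ) ≤ √(n : ℝ) := Real.one_le_sqrt.mpr (by exact_mod_cast (by omega : 1 ≤ n))
    push_cast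
    linarith
  set q := n.sqrt + 1
  set ℓ := Real.log n
  have hL' : (L : ℝ) ≤ (c + 6) * ℓ := by linarith
  have hγ' : (γ : ℝ) + 3 ≤ (a + 4) * ℓ := by linarith
  calc ((q * L + q + (γ + 1) * (q * L) + q * L : ℕ) : ℝ)
      = q * L * (γ + 3) + q := by push_cast; ring
    _ ≤ (2 * √(n : ℝ)) * ((c + 6) * ℓ) * ((a + 4) * ℓ) + (2 * √(n : ℝ)) * ℓ ^ 2 := by
        gcongr ?_ + ?_
        · gcongr
        · nlinarith [one_le_pow₀ hlog (n := 2), Real.sqrt_nonneg (n : ℝ)]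
    _ = _ := by ring

end Hybrid

theorem theorem2p3 (κ : ℕ) :
    ∃ B : ℕ, ∀ a c : ℝ, 0 < a → 0 < c →
      ∃ (C : ℝ) (k n₀ : ℕ) (T : ℕ → ℕ)
        (A : (n : ℕ) → Hybrid.Algorithm n (B * Nat.clog 2 n) ⌈a * Real.log n⌉₊),
        ∀ n : ℕ, n₀ ≤ n →
          (T n : ℝ) ≤ C * √(n : ℝ) * Real.log n ^ k ∧
          ∀ G : Hybrid.WeightedGraph n, G.graph.Connected →
            (∀ e ∈ G.graph.edgeSet, G.weight e ≤ n ^ κ) →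
            1 - 1 / (n : ℝ) ^ c ≤ (A n).prob ((A n).approxAPSPEvent G (T n) 3) := by
  refine ⟨κ + 3, fun a c ha hc => ?_⟩
  obtain ⟨N, hN⟩ := Filter.eventually_atTop.mp
    ((Hybrid.eventually_rpow_le_factorial ha (c + 6)).and
      (Hybrid.eventually_mul_log_le (a + c + 7)))
  -- The threshold 3 exceeds e and thus gives ln n ≥ 1; N makes the factorial and L, γ + 1 ≤ n
  -- estimates valid.
  refine ⟨2 * (c + 6) * (a + 4) + 2, 2, max N 3,
    fun n => Hybrid.rounds (n.sqrt + 1) (Hybrid.phaseLength c n) ⌈a * Real.log n⌉₊,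
    Hybrid.approxAPSP κ a c, ?_⟩
  intro n hn
  have hn3 : 3 ≤ n := le_of_max_le_right hn
  obtain ⟨hfac, hpoly⟩ := hN n (le_of_max_le_left hn)
  have hlog : 1 ≤ Real.log n := by
    rw [Real.le_log_iff_exp_le (by positivity)]
    have : (3 : ℝ) ≤ n := by exact_mod_cast hn3
    linarith [Real.exp_one_lt_three]
  refine ⟨Hybrid.rounds_le ha hc hn3 hlog, fun G hG hW => ?_⟩
  have : NeZero n := ⟨by omega⟩
  rw [Hybrid.approxAPSP_eq]
  exact Hybrid.apspAlgorithm_prob_ge hc hn3 hlog hpoly ha hfac hG hW
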